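/- Let $n\ge 4$ and work over $\mathbb C$. Let $(a^0_{i,j})_{0\le i,j\le n}$ be the Cartan matrix of type $D_n^{(1)}$, i.e. of $\widehat{\mathfrak{so}}(2n)$ (edges of the Dynkin diagram: $0-2$; $k-(k+1)$ for $1\le k\le n-2$; $(n-2)-n$). For $1\le i\le n-1$, $0\le j\le n$ put $a^1_{i,j}=a^0_{i,j}$, except that $a^1_{1,0}=a^1_{n-1,n}=2$; put $a^{2r}_{i,j}=a^0_{i,j}$ and $a^{2r+1}_{i,j}=a^1_{i,j}$. Call $(0,1),(1,0),(n-1,n),(n,n-1)$ the fork pairs. Write $\delta_{m,\mathrm{odd}}=1$ if $m$ is odd and $0$ otherwise. Given elements $x_i^{\pm}$ $(0\le i\le n)$ of a Lie algebra, let $\theta^{\pm}=(-1)^n\,\mathrm{ad}x^\pm_2\,\mathrm{ad}x^\pm_3\cdots\mathrm{ad}x^\pm_{n-2}\,\mathrm{ad}x^\pm_n\,\mathrm{ad}x^\pm_{n-1}\,\mathrm{ad}x^\pm_{n-2}\cdots\mathrm{ad}x^\pm_2(x^\pm_0)$, $\eta_+=[x_1^+,\theta^+]$, $\eta_-=[\theta^-,x_1^-]$,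 and for $u\in\mathbb Z$ let $T_u=\big[(\tfrac12\mathrm{ad}\,\eta_{\pm})^{|u|}(x_1^+),\,x_1^-\big]$, with $\eta_+$ if $u\ge0$ and $\eta_-$ if $u<0$. (For the Chevalley generators of $\widehat{\mathfrak{so}}(2n)$ given by $x^+_i=f_{i,i+1}$, $x^-_i=f_{i+1,i}$ for $1\le i\le n-1$, $x_n^+=f_{n-1,-n}$, $x_n^-=f_{-n,n-1}$, $x_0^+=f_{-2,1}t$, $x_0^-=f_{1,-2}t^{-1}$, where $f_{i,j}=E_{i,j}-E_{-j,-i}$, this is $T_u=(f_{1,1}-f_{2,2})t^u$.) The Lie algebra $D(2n)$ is generated by $H_{i,r}$ ($1\le i\le n-1$, $r\ge0$), $H_{0,2r},H_{n,2r}$ ($r\ge0$), $X^\pm_{i,r}$ ($0\le i\le n$, $r\ge0$) and $X^\pm_{-1,2r+1},X^\pm_{n+1,2r+1}$ ($r\ge 0$), subject to the following relations, for all indices for which the generators on the left-hand sides exist. - $[H_{i,r},H_{j,s}]=0$, and $[H_{i,r},X^\pm_{j,s}]=\pm a^r_{i,j}X^\pm_{j,r+s}$ for $0\le j\le n$. -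 For $0\le i\le n$: $[X^+_{i,r},X^-_{i,s}]=H_{i,r+s}$, except that for odd $r+s$ it is $H_{1,r+s}$ if $i=0$ and $H_{n-1,r+s}$ if $i=n$. For $0\le i\ne j\le n$ not a fork pair, $[X^+_{i,r},X^-_{j,s}]=0$. - $[X^+_{n-1,r},X^-_{n,s}]=-\delta_{r+s,\mathrm{odd}}X^-_{n+1,r+s}$, $[X^+_{n,r},X^-_{n-1,s}]=-\delta_{r+s,\mathrm{odd}}X^+_{n+1,r+s}$, $[X^+_{0,r},X^-_{1,s}]=-\delta_{r+s,\mathrm{odd}}X^+_{-1,r+s}$, $[X^+_{1,r},X^-_{0,s}]=-\delta_{r+s,\mathrm{odd}}X^-_{-1,r+s}$. - For all sign choices, $[X^{\pm}_{i,r},X^{+}_{n+1,s}]=[X^{\pm}_{i,r},X^{-}_{n+1,s}]=0$ if $1\le i\le n-2$, and $[X^{\pm}_{i,r},X^{+}_{-1,s}]=[X^{\pm}_{i,r},X^{-}_{-1,s}]=0$ if $2\le i\le n+1$. - $[X^+_{n-1,r},X^+_{n+1,s}]=2X^+_{n,r+s}$, $[X^-_{n-1,r},X^+_{n+1,s}]=0$,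 $[X^+_{n-1,r},X^-_{n+1,s}]=0$, $[X^-_{n-1,r},X^-_{n+1,s}]=-2X^-_{n,r+s}$. - $[X^+_{n,r},X^+_{n+1,s}]=0$, $[X^-_{n,r},X^+_{n+1,s}]=-2X^-_{n-1,r+s}$, $[X^+_{n,r},X^-_{n+1,s}]=2X^+_{n-1,r+s}$, $[X^-_{n,r},X^-_{n+1,s}]=0$. - $[X^+_{0,r},X^+_{-1,s}]=0$, $[X^-_{0,r},X^+_{-1,s}]=-2X^-_{1,r+s}$, $[X^+_{0,r},X^-_{-1,s}]=2X^+_{1,r+s}$, $[X^-_{0,r},X^-_{-1,s}]=0$. - $[X^+_{1,r},X^+_{-1,s}]=2X^+_{0,r+s}$, $[X^-_{1,r},X^+_{-1,s}]=0$, $[X^+_{1,r},X^-_{-1,s}]=0$, $[X^-_{1,r},X^-_{-1,s}]=-2X^-_{0,r+s}$. - $[X^\pm_{i,r},X^\pm_{i,s}]=0$ for $-1\le i\le n+1$. - For $0\le i\le j\le n$: $[X^\pm_{i,r+1},X^\pm_{j,s}]=\epsilon\,[X^\pm_{i,r},X^\pm_{j,s+1}]$ with $\epsilon=-1$ if $(i,j)\in\{(0,1),(n-1,n)\}$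 and $\epsilon=1$ otherwise. - For $0\le i\neq j\le n$ with $a^0_{i,j}=0$: $[X^\pm_{i,r},X^\pm_{j,s}]=0$, where for fork pairs this is imposed only if $r+s$ is even. If $a^0_{i,j}=-1$: $[X^\pm_{i,r},[X^\pm_{i,s},X^\pm_{j,u}]]=0$. For fork pairs: $[X^\pm_{i,0},[X^\pm_{i,0},X^\pm_{j,2r+1}]]=0$. - $[X^+_{1,1},[X^-_{1,0},T_u]]-[X^+_{1,0},[X^-_{1,1},T_u]]=0$ for all $u\in\mathbb Z$, with $T_u$ formed from $x_i^\pm=X^\pm_{i,0}$. The associative algebra $\widetilde D(2n)$ is generated by $h_{i,0}$ ($0\le i\le n$), $h_{i,1}$ ($1\le i\le n-1$) and $x^\pm_{i,0},x^\pm_{i,1}$ ($0\le i\le n$), subject to the following relations (brackets are commutators; $0\le i,j\le n$ unless restricted). - $[h_{i,r},h_{j,s}]=0$, and $[h_{i,r},x^\pm_{j,0}]=\pm a^r_{i,j}x^\pm_{j,r}$ for $r\in\{0,1\}$. - $[x^+_{i,0},x^-_{j,0}]=\delta_{i,j}h_{i,0}$; $[x^+_{i,1},x^-_{i,0}]=h_{i,1}$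 for $1\le i\le n-1$; $[x^+_{n,1},x^-_{n,0}]=h_{n-1,1}$; $[x^+_{0,1},x^-_{0,0}]=h_{1,1}$. - $[x^\pm_{i,1},x^\pm_{i,0}]=0$; $[x^\pm_{i,0},x^\pm_{j,0}]=0$ if $a^0_{i,j}=0$; $[x^\pm_{i,0},[x^\pm_{i,0},x^\pm_{j,0}]]=0$ if $a^0_{i,j}=-1$. - $[[x^+_{n-1,1},x^-_{n-1,1}],x^\pm_{n,0}]=0$ and $[[x^+_{0,1},x^-_{0,1}],x^\pm_{1,0}]=0$. - $[x^+_{1,1},[x^-_{1,0},T_u]]-[x^+_{1,0},[x^-_{1,1},T_u]]=0$ for all $u\in\mathbb Z$, with $T_u$ formed from $x_i^\pm=x^\pm_{i,0}$. Theorem. There is an isomorphism of associative algebras $\widetilde D(2n)\cong U(D(2n))$ onto the universal enveloping algebra of $D(2n)$ with $h_{i,r}\mapsto H_{i,r}$ and $x^\pm_{i,r}\mapsto X^\pm_{i,r}$ for all generators of $\widetilde D(2n)$. Moreover, the Lie algebra $D(2n)$ is generated by the elements $H_{i,0},X^\pm_{i,0},X^\pm_{i,1}$ ($0\le i\le n$)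 and $H_{i,1}$ ($1\le i\le n-1$). -/

import Mathlib

/-! Twisted toroidal Lie algebra `D(2n)` of type `D`, and the associative algebra given by the
minimalistic presentation.  Indices `i` of generators are integers between `-1` and `n + 1`. -/

namespace TwistedD

/-- The two signs in superscripts `±`. -/
inductive Sgn : Type
  | pos : Sgn
  | neg : Sgn

/-- The integer `±1` attached to a sign. -/
def Sgn.toInt : Sgn → ℤ
  | .pos => 1
  | .neg => -1

/-- The Cartan matrix of the affine Lie algebra of `so(2n)` (type `D_n^{(1)}`, nodes `0, …, n`):
the edges of its Dynkin diagram are `0 — 2`, `k — k+1` for `1 ≤ k ≤ n-2`, and `n-2 — n`. -/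
def cartanEven (n : ℕ) (i j : ℤ) : ℤ :=
  if i = j then 2
  else if (i = 0 ∧ j = 2) ∨ (1 ≤ i ∧ j = i + 1 ∧ j ≤ (n : ℤ) - 1) ∨ (i = (n : ℤ) - 2 ∧ j = n) ∨
      (j = 0 ∧ i = 2) ∨ (1 ≤ j ∧ i = j + 1 ∧ i ≤ (n : ℤ) - 1) ∨ (j = (n : ℤ) - 2 ∧ i = n) then -1
  else 0

/-- The matrix used in odd degree (rows `1 ≤ i ≤ n-1`): it differs from the Cartan matrix only
in the entries `(1, 0)` and `(n-1, n)`, which are `2`. -/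
def cartanOdd (n : ℕ) (i j : ℤ) : ℤ :=
  if (i = 1 ∧ j = 0) ∨ (i = (n : ℤ) - 1 ∧ j = n) then 2 else cartanEven n i j

/-- The numbers `a^r_{i,j}`. -/
def cartan (n r : ℕ) (i j : ℤ) : ℤ :=
  if Even r then cartanEven n i j else cartanOdd n i j

/-- The ordered pairs `(0,1), (1,0), (n-1,n), (n,n-1)`. -/
def IsFork (n : ℕ) (i j : ℤ) : Prop :=
  (i = 0 ∧ j = 1) ∨ (i = 1 ∧ j = 0) ∨ (i = (n : ℤ) - 1 ∧ j = n) ∨ (i = n ∧ j = (n : ℤ) - 1)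

section LoopElement

variable {L : Type} [AddCommGroup L] [Bracket L L] [Module ℂ L]

/-- The sequence of nodes `2, 3, …, n-2, n, n-1, n-2, …, 3, 2`. -/
def rootWord (n : ℕ) : List ℤ :=
  (List.range' 2 (n - 3) ++ [n] ++ (List.range' 2 (n - 2)).reverse).map fun k => (k : ℤ)

/-- `(-1)^n [x_2,[x_3,…[x_{n-2},[x_n,[x_{n-1},[x_{n-2},…[x_2,x_0]…]]]]…]]`.
Write `f_{i,j} = E_{i,j} - E_{-j,-i}`.  On the Chevalley generators
`x_i^+ = f_{i,i+1}` (`1 ≤ i ≤ n-1`), `x_n^+ = f_{n-1,-n}`, `x_0^+ = f_{-2,1} t` of the affine Lie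
algebra of `so(2n)` this is `f_{2,1} t`; on the generators `x_i^- = f_{i+1,i}`,
`x_n^- = f_{-n,n-1}`, `x_0^- = f_{1,-2} t^{-1}` it is `f_{1,2} t^{-1}`. -/
def rootVector (n : ℕ) (x : ℤ → L) : L :=
  ((-1 : ℤ) ^ n) • (rootWord n).foldr (fun i y => ⁅x i, y⁆) (x 0)

/-- `k ↦ (1/2 ad h)^k e`. -/
noncomputable def halfAdIter (h e : L) : ℕ → L
  | 0 => e
  | k + 1 => (1 / 2 : ℂ) • ⁅h, halfAdIter h e k⁆

/-- The element `(f_{1,1} - f_{2,2}) t^u` of the affine Lie algebra of `so(2n)`, expressed through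
its Chevalley generators `xp i = x_i^+` and `xm i = x_i^-`.  For `u ≥ 0` one has
`(f_{1,1} - f_{2,2}) t = [f_{1,2}, f_{2,1} t]`,
`f_{1,2} t^{k+1} = 1/2 [(f_{1,1} - f_{2,2}) t, f_{1,2} t^k]` and
`(f_{1,1} - f_{2,2}) t^u = [f_{1,2} t^u, f_{2,1}]`;
for `u < 0` use `(f_{1,1} - f_{2,2}) t^{-1} = [f_{1,2} t^{-1}, f_{2,1}]` instead. -/
noncomputable def loopCartan (n : ℕ) (xp xm : ℤ → L) (u : ℤ) : L :=
  ⁅halfAdIter (if 0 ≤ u then ⁅xp 1, rootVector n xp⁆ else ⁅rootVector n xm, xm 1⁆)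
    (xp 1) u.natAbs, xm 1⁆

end LoopElement

/-! ### The Lie algebra `D(2n)` -/

/-- Indices of the generators `H_{i,r}`: `1 ≤ i ≤ n-1` and any `r`, or `i ∈ {0, n}` and even `r`. -/
def ValidH (n : ℕ) (i : ℤ) (r : ℕ) : Prop :=
  (1 ≤ i ∧ i ≤ (n : ℤ) - 1) ∨ ((i = 0 ∨ i = n) ∧ Even r)

/-- Indices of the generators `X^±_{i,r}`: `0 ≤ i ≤ n` and any `r`, or `i ∈ {-1, n+1}` and
odd `r`. -/
def ValidX (n : ℕ) (i : ℤ) (r : ℕ) : Prop :=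
  (0 ≤ i ∧ i ≤ (n : ℤ)) ∨ ((i = -1 ∨ i = (n : ℤ) + 1) ∧ Odd r)

/-- The generators of `D(2n)`. -/
inductive DGen (n : ℕ) : Type
  | H (i : ℤ) (r : ℕ) (h : ValidH n i r) : DGen n
  | X (s : Sgn) (i : ℤ) (r : ℕ) (h : ValidX n i r) : DGen n

/-- The free Lie algebra on the generators of `D(2n)`. -/
abbrev DFree (n : ℕ) : Type := FreeLieAlgebra ℂ (DGen n)

open Classical in
/-- `H_{i,r}` in the free Lie algebra (`0` if there is no such generator). -/
noncomputable def DFree.H (n : ℕ) (i : ℤ) (r : ℕ) : DFree n :=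
  if h : ValidH n i r then FreeLieAlgebra.of ℂ (DGen.H i r h) else 0

open Classical in
/-- `X^±_{i,r}` in the free Lie algebra (`0` if there is no such generator). -/
noncomputable def DFree.X (n : ℕ) (s : Sgn) (i : ℤ) (r : ℕ) : DFree n :=
  if h : ValidX n i r then FreeLieAlgebra.of ℂ (DGen.X s i r h) else 0

/-- The value of `[X^+_{i,r}, X^-_{i,s}]` for `0 ≤ i ≤ n` and `m = r + s`: it is `H_{i,m}`, except
that it is `H_{1,m}` if `i = 0` and `m` is odd, and `H_{n-1,m}` if `i = n` and `m` is odd. -/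
noncomputable def DFree.coroot (n : ℕ) (i : ℤ) (m : ℕ) : DFree n :=
  if Even m then DFree.H n i m
  else if i = 0 then DFree.H n 1 m
  else if i = n then DFree.H n ((n : ℤ) - 1) m
  else DFree.H n i m

/-- `-δ_{m,odd} X^±_{i,m}` (for `i ∈ {-1, n+1}`). -/
noncomputable def DFree.negOdd (n : ℕ) (s : Sgn) (i : ℤ) (m : ℕ) : DFree n :=
  if Odd m then -DFree.X n s i m else 0

open DFree in
/-- The defining relations of `D(2n)`; `DRel n a b` is the relation `a = b`. -/
inductive DRel (n : ℕ) : DFree n → DFree n → Prop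
  | hh (i j : ℤ) (r s : ℕ) (hi : ValidH n i r) (hj : ValidH n j s) :
      DRel n ⁅H n i r, H n j s⁆ 0
  | hx (e : Sgn) (i j : ℤ) (r s : ℕ) (hi : ValidH n i r) (hj : 0 ≤ j ∧ j ≤ (n : ℤ)) :
      DRel n ⁅H n i r, X n e j s⁆ ((e.toInt * cartan n r i j) • X n e j (r + s))
  -- `[X^+, X^-]` for indices in `0, …, n`
  | xx_same (i : ℤ) (r s : ℕ) (hi : 0 ≤ i ∧ i ≤ (n : ℤ)) :
      DRel n ⁅X n .pos i r, X n .neg i s⁆ (coroot n i (r + s))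
  | xx_diff (i j : ℤ) (r s : ℕ) (hi : 0 ≤ i ∧ i ≤ (n : ℤ)) (hj : 0 ≤ j ∧ j ≤ (n : ℤ))
      (hij : i ≠ j) (hf : ¬ IsFork n i j) :
      DRel n ⁅X n .pos i r, X n .neg j s⁆ 0
  | xx_pred_last (r s : ℕ) :
      DRel n ⁅X n .pos ((n : ℤ) - 1) r, X n .neg n s⁆ (negOdd n .neg ((n : ℤ) + 1) (r + s))
  | xx_last_pred (r s : ℕ) :
      DRel n ⁅X n .pos n r, X n .neg ((n : ℤ) - 1) s⁆ (negOdd n .pos ((n : ℤ) + 1) (r + s))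
  | xx_zero_one (r s : ℕ) :
      DRel n ⁅X n .pos 0 r, X n .neg 1 s⁆ (negOdd n .pos (-1) (r + s))
  | xx_one_zero (r s : ℕ) :
      DRel n ⁅X n .pos 1 r, X n .neg 0 s⁆ (negOdd n .neg (-1) (r + s))
  -- brackets with the additional generators `X^±_{n+1,s}` and `X^±_{-1,s}`, `s` odd
  | end_far (e f : Sgn) (i : ℤ) (r s : ℕ) (hi : 1 ≤ i ∧ i ≤ (n : ℤ) - 2) (hs : Odd s) :
      DRel n ⁅X n e i r, X n f ((n : ℤ) + 1) s⁆ 0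
  | start_far (e f : Sgn) (i : ℤ) (r s : ℕ) (hi : 2 ≤ i ∧ i ≤ (n : ℤ) + 1) (hr : ValidX n i r)
      (hs : Odd s) :
      DRel n ⁅X n e i r, X n f (-1) s⁆ 0
  | end_pred_pp (r s : ℕ) (hs : Odd s) :
      DRel n ⁅X n .pos ((n : ℤ) - 1) r, X n .pos ((n : ℤ) + 1) s⁆ ((2 : ℤ) • X n .pos n (r + s))
  | end_pred_mp (r s : ℕ) (hs : Odd s) :
      DRel n ⁅X n .neg ((n : ℤ) - 1) r, X n .pos ((n : ℤ) + 1) s⁆ 0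
  | end_pred_pm (r s : ℕ) (hs : Odd s) :
      DRel n ⁅X n .pos ((n : ℤ) - 1) r, X n .neg ((n : ℤ) + 1) s⁆ 0
  | end_pred_mm (r s : ℕ) (hs : Odd s) :
      DRel n ⁅X n .neg ((n : ℤ) - 1) r, X n .neg ((n : ℤ) + 1) s⁆ ((-2 : ℤ) • X n .neg n (r + s))
  | end_last_pp (r s : ℕ) (hs : Odd s) :
      DRel n ⁅X n .pos n r, X n .pos ((n : ℤ) + 1) s⁆ 0
  | end_last_mp (r s : ℕ) (hs : Odd s) :
      DRel n ⁅X n .neg n r, X n .pos ((n : ℤ) + 1) s⁆ ((-2 : ℤ) • X n .neg ((n : ℤ) - 1) (r + s))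
  | end_last_pm (r s : ℕ) (hs : Odd s) :
      DRel n ⁅X n .pos n r, X n .neg ((n : ℤ) + 1) s⁆ ((2 : ℤ) • X n .pos ((n : ℤ) - 1) (r + s))
  | end_last_mm (r s : ℕ) (hs : Odd s) :
      DRel n ⁅X n .neg n r, X n .neg ((n : ℤ) + 1) s⁆ 0
  | start_zero_pp (r s : ℕ) (hs : Odd s) :
      DRel n ⁅X n .pos 0 r, X n .pos (-1) s⁆ 0
  | start_zero_mp (r s : ℕ) (hs : Odd s) :
      DRel n ⁅X n .neg 0 r, X n .pos (-1) s⁆ ((-2 : ℤ) • X n .neg 1 (r + s))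
  | start_zero_pm (r s : ℕ) (hs : Odd s) :
      DRel n ⁅X n .pos 0 r, X n .neg (-1) s⁆ ((2 : ℤ) • X n .pos 1 (r + s))
  | start_zero_mm (r s : ℕ) (hs : Odd s) :
      DRel n ⁅X n .neg 0 r, X n .neg (-1) s⁆ 0
  | start_one_pp (r s : ℕ) (hs : Odd s) :
      DRel n ⁅X n .pos 1 r, X n .pos (-1) s⁆ ((2 : ℤ) • X n .pos 0 (r + s))
  | start_one_mp (r s : ℕ) (hs : Odd s) :
      DRel n ⁅X n .neg 1 r, X n .pos (-1) s⁆ 0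
  | start_one_pm (r s : ℕ) (hs : Odd s) :
      DRel n ⁅X n .pos 1 r, X n .neg (-1) s⁆ 0
  | start_one_mm (r s : ℕ) (hs : Odd s) :
      DRel n ⁅X n .neg 1 r, X n .neg (-1) s⁆ ((-2 : ℤ) • X n .neg 0 (r + s))
  -- brackets of generators with equal signs, and Serre relations
  | same_node (e : Sgn) (i : ℤ) (r s : ℕ) (hr : ValidX n i r) (hs : ValidX n i s) :
      DRel n ⁅X n e i r, X n e i s⁆ 0
  | shift (e : Sgn) (i j : ℤ) (r s : ℕ) (hij : 0 ≤ i ∧ i ≤ j ∧ j ≤ (n : ℤ))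
      (hf : ¬ IsFork n i j) :
      DRel n ⁅X n e i (r + 1), X n e j s⁆ ⁅X n e i r, X n e j (s + 1)⁆
  | shift_zero_one (e : Sgn) (r s : ℕ) :
      DRel n ⁅X n e 0 (r + 1), X n e 1 s⁆ (-⁅X n e 0 r, X n e 1 (s + 1)⁆)
  | shift_pred_last (e : Sgn) (r s : ℕ) :
      DRel n ⁅X n e ((n : ℤ) - 1) (r + 1), X n e n s⁆ (-⁅X n e ((n : ℤ) - 1) r, X n e n (s + 1)⁆)
  | serre_two (e : Sgn) (i j : ℤ) (r s : ℕ) (hi : 0 ≤ i ∧ i ≤ (n : ℤ))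
      (hj : 0 ≤ j ∧ j ≤ (n : ℤ)) (hij : i ≠ j) (ha : cartan n 0 i j = 0)
      (hf : IsFork n i j → Even (r + s)) :
      DRel n ⁅X n e i r, X n e j s⁆ 0
  | serre_three (e : Sgn) (i j : ℤ) (r s u : ℕ) (hi : 0 ≤ i ∧ i ≤ (n : ℤ))
      (hj : 0 ≤ j ∧ j ≤ (n : ℤ)) (ha : cartan n 0 i j = -1) :
      DRel n ⁅X n e i r, ⁅X n e i s, X n e j u⁆⁆ 0
  | serre_fork (e : Sgn) (i j : ℤ) (r : ℕ) (hf : IsFork n i j) :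
      DRel n ⁅X n e i 0, ⁅X n e i 0, X n e j (2 * r + 1)⁆⁆ 0
  | loop (u : ℤ) :
      DRel n
        (⁅X n .pos 1 1, ⁅X n .neg 1 0,
            loopCartan n (fun i => X n .pos i 0) (fun i => X n .neg i 0) u⁆⁆ -
          ⁅X n .pos 1 0, ⁅X n .neg 1 1,
            loopCartan n (fun i => X n .pos i 0) (fun i => X n .neg i 0) u⁆⁆) 0

/-- The Lie ideal generated by the defining relations. -/
noncomputable def DIdeal (n : ℕ) : LieIdeal ℂ (DFree n) :=
  LieSubmodule.lieSpan ℂ (DFree n) {x | ∃ a b, DRel n a b ∧ x = a - b}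

/-- The Lie algebra `D(2n)`. -/
abbrev D (n : ℕ) : Type := DFree n ⧸ DIdeal n

/-- The element `H_{i,r}` of `D(2n)`. -/
noncomputable def D.H (n : ℕ) (i : ℤ) (r : ℕ) : D n := LieSubmodule.Quotient.mk (DFree.H n i r)

/-- The element `X^±_{i,r}` of `D(2n)`. -/
noncomputable def D.X (n : ℕ) (s : Sgn) (i : ℤ) (r : ℕ) : D n :=
  LieSubmodule.Quotient.mk (DFree.X n s i r)

/-! ### The associative algebra with the minimalistic presentation -/

/-- Indices of the generators `h_{i,r}`: `h_{i,0}` for `0 ≤ i ≤ n` and `h_{i,1}` for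
`1 ≤ i ≤ n-1`. -/
def ValidMinH (n : ℕ) (i : ℤ) (r : ℕ) : Prop :=
  (0 ≤ i ∧ i ≤ (n : ℤ) ∧ r = 0) ∨ (1 ≤ i ∧ i ≤ (n : ℤ) - 1 ∧ r = 1)

/-- Indices of the generators `x^±_{i,r}`: `0 ≤ i ≤ n` and `r ∈ {0, 1}`. -/
def ValidMinX (n : ℕ) (i : ℤ) (r : ℕ) : Prop :=
  0 ≤ i ∧ i ≤ (n : ℤ) ∧ (r = 0 ∨ r = 1)

/-- The generators of the minimalistic presentation. -/
inductive MinGen (n : ℕ) : Type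
  | h (i : ℤ) (r : ℕ) (hi : ValidMinH n i r) : MinGen n
  | x (s : Sgn) (i : ℤ) (r : ℕ) (hi : ValidMinX n i r) : MinGen n

/-- The free associative algebra on these generators; brackets in it are commutators. -/
abbrev MinFree (n : ℕ) : Type := FreeAlgebra ℂ (MinGen n)

open Classical in
/-- `h_{i,r}` in the free algebra (`0` if there is no such generator). -/
noncomputable def MinFree.h (n : ℕ) (i : ℤ) (r : ℕ) : MinFree n :=
  if hi : ValidMinH n i r then FreeAlgebra.ι ℂ (MinGen.h i r hi) else 0

open Classical in
/-- `x^±_{i,r}` in the free algebra (`0` if there is no such generator). -/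
noncomputable def MinFree.x (n : ℕ) (s : Sgn) (i : ℤ) (r : ℕ) : MinFree n :=
  if hi : ValidMinX n i r then FreeAlgebra.ι ℂ (MinGen.x s i r hi) else 0

open MinFree in
/-- The minimalistic relations; `MinRel n a b` is the relation `a = b`. -/
inductive MinRel (n : ℕ) : MinFree n → MinFree n → Prop
  | hh (i j : ℤ) (r s : ℕ) (hi : ValidMinH n i r) (hj : ValidMinH n j s) :
      MinRel n ⁅h n i r, h n j s⁆ 0
  | hx (e : Sgn) (i j : ℤ) (r : ℕ) (hi : ValidMinH n i r) (hj : 0 ≤ j ∧ j ≤ (n : ℤ)) :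
      MinRel n ⁅h n i r, x n e j 0⁆ ((e.toInt * cartan n r i j) • x n e j r)
  | xx_same (i : ℤ) (hi : 0 ≤ i ∧ i ≤ (n : ℤ)) :
      MinRel n ⁅x n .pos i 0, x n .neg i 0⁆ (h n i 0)
  | xx_diff (i j : ℤ) (hi : 0 ≤ i ∧ i ≤ (n : ℤ)) (hj : 0 ≤ j ∧ j ≤ (n : ℤ)) (hij : i ≠ j) :
      MinRel n ⁅x n .pos i 0, x n .neg j 0⁆ 0
  | xx_one_mid (i : ℤ) (hi : 1 ≤ i ∧ i ≤ (n : ℤ) - 1) :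
      MinRel n ⁅x n .pos i 1, x n .neg i 0⁆ (h n i 1)
  | xx_one_last :
      MinRel n ⁅x n .pos n 1, x n .neg n 0⁆ (h n ((n : ℤ) - 1) 1)
  | xx_one_zero :
      MinRel n ⁅x n .pos 0 1, x n .neg 0 0⁆ (h n 1 1)
  | same_node (e : Sgn) (i : ℤ) (hi : 0 ≤ i ∧ i ≤ (n : ℤ)) :
      MinRel n ⁅x n e i 1, x n e i 0⁆ 0
  | serre_two (e : Sgn) (i j : ℤ) (hi : 0 ≤ i ∧ i ≤ (n : ℤ)) (hj : 0 ≤ j ∧ j ≤ (n : ℤ))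
      (ha : cartan n 0 i j = 0) :
      MinRel n ⁅x n e i 0, x n e j 0⁆ 0
  | serre_three (e : Sgn) (i j : ℤ) (hi : 0 ≤ i ∧ i ≤ (n : ℤ)) (hj : 0 ≤ j ∧ j ≤ (n : ℤ))
      (ha : cartan n 0 i j = -1) :
      MinRel n ⁅x n e i 0, ⁅x n e i 0, x n e j 0⁆⁆ 0
  | fork_last (e : Sgn) :
      MinRel n ⁅⁅x n .pos ((n : ℤ) - 1) 1, x n .neg ((n : ℤ) - 1) 1⁆, x n e n 0⁆ 0
  | fork_zero (e : Sgn) :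
      MinRel n ⁅⁅x n .pos 0 1, x n .neg 0 1⁆, x n e 1 0⁆ 0
  | loop (u : ℤ) :
      MinRel n
        (⁅x n .pos 1 1, ⁅x n .neg 1 0,
            loopCartan n (fun i => x n .pos i 0) (fun i => x n .neg i 0) u⁆⁆ -
          ⁅x n .pos 1 0, ⁅x n .neg 1 1,
            loopCartan n (fun i => x n .pos i 0) (fun i => x n .neg i 0) u⁆⁆) 0

/-- The associative algebra `D̃(2n)` given by the minimalistic presentation. -/
abbrev DMin (n : ℕ) : Type := RingQuot (MinRel n)

/-- The element `h_{i,r}` of `D̃(2n)`. -/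
noncomputable def DMin.h (n : ℕ) (i : ℤ) (r : ℕ) : DMin n :=
  RingQuot.mkAlgHom ℂ (MinRel n) (MinFree.h n i r)

/-- The element `x^±_{i,r}` of `D̃(2n)`. -/
noncomputable def DMin.x (n : ℕ) (s : Sgn) (i : ℤ) (r : ℕ) : DMin n :=
  RingQuot.mkAlgHom ℂ (MinRel n) (MinFree.x n s i r)

end TwistedD

/-!
Write `t_i` for `h_{i,1}`, with the convention that `t_0 = h_{1,1}` and `t_n = h_{n-1,1}`. Since
`[t_i, x^±_{i,r}] = ± 2 x^±_{i,r+1}`, the `t_i` produce from the generators of `D̃(2n)` elements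
`x^±_{i,r}` of all degrees, and the point is that these satisfy the relations of `D(2n)`.

If `(i, j)` is not a fork pair, the `2 × 2` block of the odd matrix at `i` and `j` is invertible.
A combination of `t_i` and `t_j` then raises the degree at one of the two nodes only, and the
relations of degree `0` propagate to all degrees. That `[x^+_{i,r}, x^-_{i,s}]` depends on
`m = r + s` only amounts to `[t_i, H_{i,m}] = 0`. By induction on `m`, computing `[t_j, H_{i,m}]` in
two ways for a neighbour `j` of `i` gives `[t_i, H_{i,m}] = -m [t_j, H_{j,m}]`, hence
`(1 - m²) [t_i, H_{i,m}] = 0`; the case `m = 1` is a defining relation.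

For a fork pair the block is singular. The extra fork relation says that `H_{i,2}` commutes with
`x^±_{j,0}`, so that `H_{i,2}` raises the degree at `i` by two without moving the one at `j`: the
brackets of even total degree vanish, and those of odd total degree are the generators
`X^±_{-1,r}` and `X^±_{n+1,r}`.

The two resulting homomorphisms are inverse to each other because the elements of low degree
generate `D(2n)`.
-/

namespace TwistedD

instance : Neg Sgn := ⟨fun | .pos => .neg | .neg => .pos⟩

theorem Sgn.toInt_neg (e : Sgn) : (-e).toInt = -e.toInt := by cases e <;> rfl

theorem Sgn.toInt_ne_zero (e : Sgn) : e.toInt ≠ 0 := by cases e <;> decide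

/-- A simply laced Cartan matrix `even`, together with a matrix `odd` which agrees with it except
that some pairs of nonadjacent nodes, the fork pairs, have entry `2` instead of `0`. -/
structure ForkedCartanMatrix (I : Type*) where
  even : I → I → ℤ
  odd : I → I → ℤ
  even_self (i : I) : even i i = 2
  odd_self (i : I) : odd i i = 2
  even_symm (i j : I) : even i j = even j i
  odd_symm (i j : I) : odd i j = odd j i
  even_odd_of_ne {i j : I} (hij : i ≠ j) :
    (even i j = -1 ∧ odd i j = -1) ∨ (even i j = 0 ∧ odd i j = 0) ∨ (even i j = 0 ∧ odd i j = 2)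
  exists_adj (i : I) : ∃ j, even i j = -1
  exists_adj_adj {i j : I} (hij : even i j = 0) (hij' : odd i j = 2) :
    ∃ k, even k i = -1 ∧ even k j = -1

namespace ForkedCartanMatrix

variable {I : Type*} (M : ForkedCartanMatrix I) {i j : I}

/-- The adjacency relation of the Dynkin diagram of `M.even`. -/
def Adj (i j : I) : Prop := M.even i j = -1

/-- The pairs of nodes at which the two matrices differ. -/
def Fork (i j : I) : Prop := M.even i j = 0 ∧ M.odd i j = 2

/-- The entry relevant in degree `m`; it depends on the parity of `m` only. -/
def entry (m : ℕ) (i j : I) : ℤ := if Even m then M.even i j else M.odd i j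

variable {M}

theorem Adj.symm (ha : M.Adj i j) : M.Adj j i := (M.even_symm j i).trans ha

theorem Adj.ne (ha : M.Adj i j) : i ≠ j := by
  rintro rfl
  simp [Adj, M.even_self] at ha

theorem Adj.not_fork (ha : M.Adj i j) : ¬ M.Fork i j := fun hf => by
  simp [Adj, hf.1] at ha

theorem Adj.odd_eq (ha : M.Adj i j) : M.odd i j = -1 := by
  have := M.even_odd_of_ne ha.ne
  unfold Adj at ha
  omega

theorem Fork.symm (hf : M.Fork i j) : M.Fork j i :=
  ⟨(M.even_symm j i).trans hf.1, (M.odd_symm j i).trans hf.2⟩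

theorem Fork.ne (hf : M.Fork i j) : i ≠ j := by
  rintro rfl
  simp [Fork, M.even_self] at hf

theorem Fork.not_adj (hf : M.Fork i j) : ¬ M.Adj i j := fun ha => ha.not_fork hf

theorem even_eq_zero (hij : i ≠ j) (ha : ¬ M.Adj i j) : M.even i j = 0 := by
  have := M.even_odd_of_ne hij
  unfold Adj at ha
  omega

theorem odd_eq_zero (hij : i ≠ j) (ha : ¬ M.Adj i j) (hf : ¬ M.Fork i j) : M.odd i j = 0 := by
  have := M.even_odd_of_ne hij
  unfold Adj at ha
  unfold Fork at hf
  omega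

theorem four_sub_odd_sq_ne_zero (hij : i ≠ j) (hf : ¬ M.Fork i j) : 4 - M.odd i j ^ 2 ≠ 0 := by
  by_cases ha : M.Adj i j
  · simp [ha.odd_eq]
  · simp [odd_eq_zero hij ha hf]

end ForkedCartanMatrix

section Shift

variable {L : Type*} [LieRing L] {a b : ℕ → L} {d : L} {k : ℕ}

theorem lie_lie_of_shift {α β : ℤ} (ha : ∀ r, ⁅d, a r⁆ = α • a (r + k))
    (hb : ∀ s, ⁅d, b s⁆ = β • b (s + k)) (r s : ℕ) :
    ⁅d, ⁅a r, b s⁆⁆ = α • ⁅a (r + k), b s⁆ + β • ⁅a r, b (s + k)⁆ := by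
  rw [leibniz_lie, ha, hb, smul_lie, lie_smul]

theorem lie_add_eq_zero_of_shift [IsAddTorsionFree L] {α : ℤ} (hα : α ≠ 0)
    (ha : ∀ r, ⁅d, a r⁆ = α • a (r + k)) (hb : ∀ s, ⁅d, b s⁆ = 0) {r s : ℕ}
    (h : ⁅a r, b s⁆ = 0) : ⁅a (r + k), b s⁆ = 0 := by
  have := leibniz_lie d (a r) (b s)
  rw [h, ha, hb, lie_zero, lie_zero, add_zero, smul_lie] at this
  exact (smul_eq_zero_iff_right hα).1 this.symm

end Shift

section CurrentSystem

variable {I L : Type*} [LieRing L] {M : ForkedCartanMatrix I} {x : Sgn → I → ℕ → L} {t h : I → L}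

/-- Elements `x^±_{i,r}` attached to the nodes of a diagram, together with `t_i` (of degree one)
and `h_i` (of degree zero), subject to the relations of low degree: this is what the minimalistic
presentation provides once the `x^±_{i,r}` with `r ≥ 2` have been defined by `t_lie`. -/
structure CurrentSystem (M : ForkedCartanMatrix I) (x : Sgn → I → ℕ → L) (t h : I → L) :
    Prop where
  t_lie (e : Sgn) (i j : I) (r : ℕ) : ⁅t i, x e j r⁆ = (e.toInt * M.odd i j) • x e j (r + 1)
  h_lie (e : Sgn) (i j : I) (r : ℕ) : ⁅h i, x e j r⁆ = (e.toInt * M.even i j) • x e j r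
  t_t (i j : I) : ⁅t i, t j⁆ = 0
  t_h (i j : I) : ⁅t i, h j⁆ = 0
  pos_neg (i : I) : ⁅x .pos i 0, x .neg i 0⁆ = h i
  pos_one_neg (i : I) : ⁅x .pos i 1, x .neg i 0⁆ = t i
  pos_neg_of_ne {i j : I} (hij : i ≠ j) : ⁅x .pos i 0, x .neg j 0⁆ = 0
  one_zero (e : Sgn) (i : I) : ⁅x e i 1, x e i 0⁆ = 0
  serre_two (e : Sgn) {i j : I} (hij : M.even i j = 0) : ⁅x e i 0, x e j 0⁆ = 0
  serre_three (e : Sgn) {i j : I} (ha : M.Adj i j) : ⁅x e i 0, ⁅x e i 0, x e j 0⁆⁆ = 0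
  fork {i j : I} (hf : M.Fork i j) : (∀ e, ⁅⁅x .pos i 1, x .neg i 1⁆, x e j 0⁆ = 0) ∨
    (∀ e, ⁅⁅x .pos j 1, x .neg j 1⁆, x e i 0⁆ = 0)

/-- The element `[x^+_{i,m}, x^-_{i,0}]`, which plays the role of `H_{i,m}`. -/
def loopCoroot (x : Sgn → I → ℕ → L) (i : I) (m : ℕ) : L := ⁅x .pos i m, x .neg i 0⁆

/-- The element `[x^+_{i,m}, x^-_{j,0}]`; for fork pairs `(i, j)` and odd `m` it plays, up to
sign, the role of the generators `X^±_{-1,m}` and `X^±_{n+1,m}`. -/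
def forkElement (x : Sgn → I → ℕ → L) (i j : I) (m : ℕ) : L := ⁅x .pos i m, x .neg j 0⁆

/-- All brackets `[x^+_{i,r}, x^-_{i,s}]` of total degree `m` agree. -/
def BracketDependsOnDegree (x : Sgn → I → ℕ → L) (m : ℕ) : Prop :=
  ∀ i r s, r + s = m → ⁅x .pos i r, x .neg i s⁆ = loopCoroot x i m

namespace CurrentSystem

theorem loopCoroot_zero (S : CurrentSystem M x t h) (i : I) : loopCoroot x i 0 = h i := S.pos_neg i

theorem loopCoroot_one (S : CurrentSystem M x t h) (i : I) : loopCoroot x i 1 = t i :=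
  S.pos_one_neg i

theorem t_lie_self (S : CurrentSystem M x t h) (e : Sgn) (i : I) (r : ℕ) :
    ⁅t i, x e i r⁆ = (2 * e.toInt) • x e i (r + 1) := by
  rw [S.t_lie, M.odd_self, mul_comm]

theorem h_lie_self (S : CurrentSystem M x t h) (e : Sgn) (i : I) (r : ℕ) :
    ⁅h i, x e i r⁆ = (2 * e.toInt) • x e i r := by
  rw [S.h_lie, M.even_self, mul_comm]

theorem t_lie_of_adj (S : CurrentSystem M x t h) (e : Sgn) {i j : I} (ha : M.Adj i j) (r : ℕ) :
    ⁅t i, x e j r⁆ = (-e.toInt) • x e j (r + 1) := by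
  rw [S.t_lie, ha.odd_eq, mul_neg_one]

theorem h_lie_of_adj (S : CurrentSystem M x t h) (e : Sgn) {i j : I} (ha : M.Adj i j) (r : ℕ) :
    ⁅h i, x e j r⁆ = (-e.toInt) • x e j r := by
  rw [S.h_lie, ha, mul_neg_one]

theorem t_lie_of_fork (S : CurrentSystem M x t h) (e : Sgn) {i j : I} (hf : M.Fork i j) (r : ℕ) :
    ⁅t i, x e j r⁆ = (2 * e.toInt) • x e j (r + 1) := by
  rw [S.t_lie, hf.2, mul_comm]

/-- Off the fork pairs the block of `M.odd` at `i` and `j` is invertible, so some combination of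
`t_i` and `t_j` shifts the degree at `i` only. -/
theorem exists_separating (S : CurrentSystem M x t h) {i j : I} (hij : i ≠ j)
    (hf : ¬ M.Fork i j) : ∃ (d : L) (c : Sgn → ℤ), (∀ e, c e ≠ 0) ∧
      (∀ e r, ⁅d, x e i r⁆ = c e • x e i (r + 1)) ∧ ∀ e r, ⁅d, x e j r⁆ = 0 := by
  refine ⟨(2 : ℤ) • t i - M.odd i j • t j, fun e => e.toInt * (4 - M.odd i j ^ 2),
    fun e => mul_ne_zero e.toInt_ne_zero (M.four_sub_odd_sq_ne_zero hij hf),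
    fun e r => ?_, fun e r => ?_⟩
  · rw [sub_lie, smul_lie, smul_lie, S.t_lie_self, S.t_lie, M.odd_symm j i]
    module
  · rw [sub_lie, smul_lie, smul_lie, S.t_lie_self, S.t_lie]
    module

theorem two_smul_lie_pos_neg (S : CurrentSystem M x t h) {m : ℕ}
    (hm : BracketDependsOnDegree x m) (i : I) {r s : ℕ} (hrs : r + s = m + 1) :
    (2 : ℤ) • ⁅x .pos i r, x .neg i s⁆ =
      (2 : ℤ) • loopCoroot x i (m + 1) - (s : ℤ) • ⁅t i, loopCoroot x i m⁆ := by
  induction s generalizing r with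
  | zero =>
    obtain rfl : r = m + 1 := hrs
    rw [Nat.cast_zero, zero_smul, sub_zero]
    rfl
  | succ s ih =>
    have step := lie_lie_of_shift (S.t_lie_self .pos i) (S.t_lie_self .neg i) r s
    rw [hm i r s (by omega)] at step
    simp only [Sgn.toInt] at step
    push_cast
    linear_combination (norm := module) ih (r := r + 1) (by omega) + step

variable [IsAddTorsionFree L]

theorem pos_neg_one (S : CurrentSystem M x t h) (i : I) : ⁅x .pos i 0, x .neg i 1⁆ = t i := by
  have key := lie_lie_of_shift (S.t_lie_self .pos i) (S.t_lie_self .neg i) 0 0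
  rw [S.pos_neg, S.t_h, zero_add, S.pos_one_neg] at key
  refine zsmul_right_injective two_ne_zero ?_
  linear_combination (norm := (simp only [Sgn.toInt]; module)) key

/-- The Chevalley involution, which reduces statements about the `x^-` to those about the `x^+`. -/
theorem chevalley (S : CurrentSystem M x t h) :
    CurrentSystem M (fun e => x (-e)) (fun i => -t i) (fun i => -h i) where
  t_lie e i j r := by rw [neg_lie, S.t_lie, Sgn.toInt_neg]; module
  h_lie e i j r := by rw [neg_lie, S.h_lie, Sgn.toInt_neg]; module
  t_t i j := by rw [neg_lie, lie_neg, S.t_t, neg_zero, neg_zero]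
  t_h i j := by rw [neg_lie, lie_neg, S.t_h, neg_zero, neg_zero]
  pos_neg i := by rw [← S.pos_neg i, lie_skew]; rfl
  pos_one_neg i := by rw [← S.pos_neg_one i, lie_skew]; rfl
  pos_neg_of_ne hij := by rw [← lie_skew, neg_eq_zero]; exact S.pos_neg_of_ne hij.symm
  one_zero e i := S.one_zero _ i
  serre_two e _ _ h0 := S.serre_two _ h0
  serre_three e _ _ ha := S.serre_three _ ha
  fork {i j} hf := by
    refine (S.fork hf).imp (fun H e => ?_) (fun H e => ?_)
    all_goals
      rw [← lie_skew (x (-Sgn.pos) _ 1), neg_lie, neg_eq_zero]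
      exact H _

theorem lie_eq_zero_of_not_fork (S : CurrentSystem M x t h) {e e' : Sgn} {i j : I} (hij : i ≠ j)
    (hf : ¬ M.Fork i j) (h0 : ⁅x e i 0, x e' j 0⁆ = 0) (r s : ℕ) : ⁅x e i r, x e' j s⁆ = 0 := by
  obtain ⟨d, c, hc, hdi, hdj⟩ := S.exists_separating hij hf
  obtain ⟨d', c', hc', hdj', hdi'⟩ := S.exists_separating hij.symm fun H => hf H.symm
  induction s with
  | succ s ih =>
    rw [← lie_skew, neg_eq_zero] at ih ⊢
    exact lie_add_eq_zero_of_shift (hc' e') (hdj' e') (hdi' e) ih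
  | zero =>
    induction r with
    | zero => exact h0
    | succ r ih => exact lie_add_eq_zero_of_shift (hc e) (hdi e) (hdj e') ih

theorem zero_lie_neg_zero (S : CurrentSystem M x t h) (e : Sgn) {i j : I} (hij : i ≠ j) :
    ⁅x e i 0, x (-e) j 0⁆ = 0 := by
  cases e
  · exact S.pos_neg_of_ne hij
  · exact S.chevalley.pos_neg_of_ne hij

theorem lie_neg_eq_zero (S : CurrentSystem M x t h) (e : Sgn) {i j : I} (hij : i ≠ j)
    (hf : ¬ M.Fork i j) (r s : ℕ) : ⁅x e i r, x (-e) j s⁆ = 0 :=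
  S.lie_eq_zero_of_not_fork hij hf (S.zero_lie_neg_zero e hij) r s

theorem pos_neg_eq_zero (S : CurrentSystem M x t h) {i j : I} (hij : i ≠ j)
    (hf : ¬ M.Fork i j) (r s : ℕ) : ⁅x .pos i r, x .neg j s⁆ = 0 :=
  S.lie_neg_eq_zero .pos hij hf r s

theorem neg_pos_eq_zero (S : CurrentSystem M x t h) {i j : I} (hij : i ≠ j)
    (hf : ¬ M.Fork i j) (r s : ℕ) : ⁅x .neg i r, x .pos j s⁆ = 0 :=
  S.lie_neg_eq_zero .neg hij hf r s

theorem zero_lie_zero (S : CurrentSystem M x t h) (e e' : Sgn) {i j : I} (hij : i ≠ j)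
    (ha : ¬ M.Adj i j) : ⁅x e i 0, x e' j 0⁆ = 0 := by
  have h0 := M.even_eq_zero hij ha
  cases e <;> cases e'
  exacts [S.serre_two _ h0, S.zero_lie_neg_zero .pos hij, S.zero_lie_neg_zero .neg hij,
    S.serre_two _ h0]

theorem lie_eq_zero_of_far (S : CurrentSystem M x t h) (e e' : Sgn) {i j : I} (hij : i ≠ j)
    (ha : ¬ M.Adj i j) (hf : ¬ M.Fork i j) (r s : ℕ) : ⁅x e i r, x e' j s⁆ = 0 :=
  S.lie_eq_zero_of_not_fork hij hf (S.zero_lie_zero e e' hij ha) r s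

/-- Shift the cubic Serre relation at `i`, then apply `x^-_{i,0}`. -/
theorem shift_adj_pos_zero (S : CurrentSystem M x t h) {i j : I} (ha : M.Adj i j) :
    ⁅x .pos i 1, x .pos j 0⁆ = ⁅x .pos i 0, x .pos j 1⁆ := by
  obtain ⟨d, c, hc, hdi, hdj⟩ := S.exists_separating ha.ne ha.not_fork
  have shifted : ⁅x .pos i 0, ⁅x .pos i 1, x .pos j 0⁆⁆ = 0 := by
    have key := congrArg (⁅d, ·⁆) (S.serre_three .pos ha)
    simp only [leibniz_lie d, hdi, hdj, lie_zero, zero_add, add_zero, smul_lie, lie_smul] at key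
    rw [leibniz_lie (x .pos i 1), S.one_zero, zero_lie, zero_add, ← two_smul ℤ] at key
    exact (smul_eq_zero_iff_right (hc _)).1 ((smul_eq_zero_iff_right two_ne_zero).1 key)
  have hh : ⁅x .neg i 0, x .pos i 0⁆ = -h i := by rw [← lie_skew, S.pos_neg]
  have ht : ⁅x .neg i 0, x .pos i 1⁆ = -t i := by rw [← lie_skew, S.pos_one_neg]
  have key := congrArg (⁅x .neg i 0, ·⁆) shifted
  simp only [leibniz_lie (x .neg i 0), S.neg_pos_eq_zero ha.ne ha.not_fork, hh, ht, lie_zero,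
    add_zero, neg_lie, lie_neg, leibniz_lie (h i), S.h_lie_self, S.h_lie_of_adj _ ha,
    S.t_lie_of_adj _ ha, Sgn.toInt, smul_lie, lie_smul] at key
  linear_combination (norm := module) -key

theorem shift_adj (S : CurrentSystem M x t h) (e : Sgn) {i j : I} (ha : M.Adj i j) (r s : ℕ) :
    ⁅x e i (r + 1), x e j s⁆ = ⁅x e i r, x e j (s + 1)⁆ := by
  have h0 : ⁅x e i 1, x e j 0⁆ = ⁅x e i 0, x e j 1⁆ := by
    cases e
    exacts [S.shift_adj_pos_zero ha, S.chevalley.shift_adj_pos_zero ha]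
  obtain ⟨d, c, hc, hdi, hdj⟩ := S.exists_separating ha.ne ha.not_fork
  obtain ⟨d', c', hc', hdj', hdi'⟩ := S.exists_separating ha.ne.symm ha.symm.not_fork
  induction s with
  | succ s ih =>
    have key := congrArg (⁅d', ·⁆) ih
    simp only [leibniz_lie d', hdi', hdj', zero_lie, zero_add, lie_smul] at key
    exact zsmul_right_injective (hc' e) key
  | zero =>
    induction r with
    | zero => exact h0
    | succ r ih =>
      have key := congrArg (⁅d, ·⁆) ih
      simp only [leibniz_lie d, hdi, hdj, lie_zero, add_zero, smul_lie] at key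
      exact zsmul_right_injective (hc e) key

theorem lie_of_adj (S : CurrentSystem M x t h) (e : Sgn) {i j : I} (ha : M.Adj i j) (r s : ℕ) :
    ⁅x e i r, x e j s⁆ = ⁅x e i 0, x e j (s + r)⁆ := by
  induction r generalizing s with
  | zero => rfl
  | succ r ih => rw [S.shift_adj e ha, ih, add_right_comm, add_assoc]

theorem serre_adj_zero (S : CurrentSystem M x t h) (e : Sgn) {i j : I} (ha : M.Adj i j)
    (r u : ℕ) : ⁅x e i r, ⁅x e i 0, x e j u⁆⁆ = 0 := by
  obtain ⟨d, c, hc, hdi, hdj⟩ := S.exists_separating ha.ne ha.not_fork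
  obtain ⟨d', c', hc', hdj', hdi'⟩ := S.exists_separating ha.ne.symm ha.symm.not_fork
  induction r generalizing u with
  | zero =>
    induction u with
    | zero => exact S.serre_three e ha
    | succ u ih =>
      have key := congrArg (⁅d', ·⁆) ih
      simp only [leibniz_lie d', hdi', hdj', zero_lie, zero_add, lie_smul, lie_zero] at key
      exact (smul_eq_zero_iff_right (hc' e)).1 key
  | succ r ih =>
    have key := congrArg (⁅d, ·⁆) (ih u)
    rw [leibniz_lie d, leibniz_lie d (x e i 0), hdi, hdi, hdj, lie_zero, add_zero, lie_zero,
      smul_lie, smul_lie, lie_smul, S.shift_adj e ha, ih, smul_zero, add_zero] at key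
    exact (smul_eq_zero_iff_right (hc e)).1 key

theorem serre_adj (S : CurrentSystem M x t h) (e : Sgn) {i j : I} (ha : M.Adj i j)
    (r s u : ℕ) : ⁅x e i r, ⁅x e i s, x e j u⁆⁆ = 0 := by
  rw [S.lie_of_adj e ha, S.serre_adj_zero e ha]

/-- The bracket commutes with `x^±_{j,0}` for a neighbour `j` of `i`, hence with `h_j`. -/
theorem same_node_pos (S : CurrentSystem M x t h) (i : I) (r s : ℕ) :
    ⁅x .pos i r, x .pos i s⁆ = 0 := by
  obtain ⟨j, ha⟩ := M.exists_adj i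
  replace ha : M.Adj i j := ha
  have hp : ⁅⁅x .pos i r, x .pos i s⁆, x .pos j 0⁆ = 0 := by
    rw [lie_lie, S.serre_adj _ ha, S.serre_adj _ ha, sub_zero]
  have hn : ⁅⁅x .pos i r, x .pos i s⁆, x .neg j 0⁆ = 0 := by
    rw [lie_lie, S.pos_neg_eq_zero ha.ne ha.not_fork, S.pos_neg_eq_zero ha.ne ha.not_fork,
      lie_zero, lie_zero, sub_zero]
  have hh : ⁅h j, ⁅x .pos i r, x .pos i s⁆⁆ = 0 := by
    rw [← lie_skew, neg_eq_zero, ← S.pos_neg, leibniz_lie, hp, hn, zero_lie, lie_zero, add_zero]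
  rw [leibniz_lie, S.h_lie_of_adj _ ha.symm, S.h_lie_of_adj _ ha.symm, smul_lie, lie_smul,
    ← add_smul] at hh
  exact (smul_eq_zero_iff_right (by decide)).1 hh

theorem same_node (S : CurrentSystem M x t h) (e : Sgn) (i : I) (r s : ℕ) :
    ⁅x e i r, x e i s⁆ = 0 := by
  cases e
  exacts [S.same_node_pos i r s, S.chevalley.same_node_pos i r s]

theorem lie_pos_neg_pos_adj (S : CurrentSystem M x t h) {i j : I} (ha : M.Adj i j)
    (r s u : ℕ) :
    ⁅⁅x .pos i r, x .neg i s⁆, x .pos j u⁆ = ⁅⁅x .pos i 0, x .neg i s⁆, x .pos j (u + r)⁆ := by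
  rw [lie_lie, lie_lie, S.neg_pos_eq_zero ha.ne ha.not_fork, S.neg_pos_eq_zero ha.ne ha.not_fork,
    lie_zero, lie_zero, S.lie_of_adj _ ha]

theorem loopCoroot_lie_adj_of (S : CurrentSystem M x t h) {m : ℕ}
    (hm : BracketDependsOnDegree x m) (e : Sgn) {i j : I} (ha : M.Adj i j) (u : ℕ) :
    ⁅loopCoroot x i m, x e j u⁆ = (-e.toInt) • x e j (u + m) := by
  rcases m with _ | m
  · rw [S.loopCoroot_zero, S.h_lie_of_adj _ ha, add_zero]
  · cases e
    · rw [← hm i m 1 rfl, S.lie_pos_neg_pos_adj ha, S.pos_neg_one, S.t_lie_of_adj _ ha, add_assoc]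
    · have key : ⁅⁅x .neg i m, x .pos i 1⁆, x .neg j u⁆ =
          ⁅⁅x .neg i 0, x .pos i 1⁆, x .neg j (u + m)⁆ :=
        S.chevalley.lie_pos_neg_pos_adj ha m 1 u
      rw [← hm i 1 m (add_comm 1 m), ← lie_skew (x .pos i 1), neg_lie, key,
        ← lie_skew (x .neg i 0), neg_lie, neg_neg, S.pos_one_neg, S.t_lie_of_adj _ ha, add_assoc]

/-- Compute `[H_{i,m}, t_j]` in two ways, expanding `t_j` or expanding `H_{i,m}`. -/
theorem t_lie_loopCoroot_of_adj (S : CurrentSystem M x t h) {m : ℕ}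
    (hm : BracketDependsOnDegree x m) {i j : I} (ha : M.Adj i j) :
    ⁅t i, loopCoroot x i m⁆ = (-m : ℤ) • ⁅t j, loopCoroot x j m⁆ := by
  have expand_t := lie_lie_of_shift (S.loopCoroot_lie_adj_of hm .pos ha)
    (S.loopCoroot_lie_adj_of hm .neg ha) 1 0
  have expand_loopCoroot : ⁅t j, loopCoroot x i m⁆ = _ :=
    lie_lie_of_shift (S.t_lie_of_adj .pos ha.symm) (S.t_lie_of_adj .neg ha.symm) m 0
  rw [S.pos_one_neg, ← lie_skew, expand_loopCoroot, zero_add, zero_add] at expand_t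
  simp only [Sgn.toInt] at expand_t
  have hi := S.two_smul_lie_pos_neg hm i (r := m + 1) (s := 0) rfl
  have hi' := S.two_smul_lie_pos_neg hm i (r := m) (s := 1) rfl
  have hj := S.two_smul_lie_pos_neg hm j (r := 1 + m) (s := 0) (by omega)
  have hj' := S.two_smul_lie_pos_neg hm j (r := 1) (s := m) (add_comm 1 m)
  push_cast at hi hi' hj hj'
  linear_combination (norm := module) (2 : ℤ) • expand_t - hi + hi' - hj + hj'

theorem t_lie_loopCoroot_self_of (S : CurrentSystem M x t h) {m : ℕ}
    (hm : BracketDependsOnDegree x m) (i : I) : ⁅t i, loopCoroot x i m⁆ = 0 := by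
  obtain ⟨j, ha⟩ := M.exists_adj i
  replace ha : M.Adj i j := ha
  by_cases h1 : m = 1
  · rw [h1, S.loopCoroot_one, S.t_t]
  · have hne : 1 - (m : ℤ) ^ 2 ≠ 0 := fun h0 => h1 (by
      have : (m : ℤ) ^ 2 = 1 ^ 2 := by linarith
      exact_mod_cast (sq_eq_sq₀ (Int.natCast_nonneg m) zero_le_one).1 this)
    refine (smul_eq_zero_iff_right hne).1 ?_
    have hij := S.t_lie_loopCoroot_of_adj hm ha
    rw [S.t_lie_loopCoroot_of_adj hm ha.symm, smul_smul] at hij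
    linear_combination (norm := module) hij

theorem bracketDependsOnDegree (S : CurrentSystem M x t h) (m : ℕ) :
    BracketDependsOnDegree x m := by
  induction m with
  | zero =>
    intro i r s hrs
    obtain ⟨rfl, rfl⟩ : r = 0 ∧ s = 0 := by omega
    rfl
  | succ m ih =>
    intro i r s hrs
    refine zsmul_right_injective (n := 2) two_ne_zero ?_
    simp only [S.two_smul_lie_pos_neg ih i hrs, S.t_lie_loopCoroot_self_of ih, smul_zero, sub_zero]

theorem lie_pos_neg_self (S : CurrentSystem M x t h) (i : I) (r s : ℕ) :
    ⁅x .pos i r, x .neg i s⁆ = loopCoroot x i (r + s) :=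
  S.bracketDependsOnDegree _ i r s rfl

theorem loopCoroot_chevalley (S : CurrentSystem M x t h) (i : I) (m : ℕ) :
    loopCoroot (fun e => x (-e)) i m = -loopCoroot x i m := by
  rw [← zero_add m, ← S.lie_pos_neg_self, lie_skew, zero_add]
  rfl

theorem loopCoroot_lie_of_adj (S : CurrentSystem M x t h) (e : Sgn) {i j : I} (ha : M.Adj i j)
    (m u : ℕ) : ⁅loopCoroot x i m, x e j u⁆ = (-e.toInt) • x e j (u + m) :=
  S.loopCoroot_lie_adj_of (S.bracketDependsOnDegree m) e ha u

/-- Since the `x^+_{i,r}` commute, `[H_{i,m}, x^+_{i,u}]` is symmetric in the two occurrences of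
`x^+_i`, which reduces to the action of `h_i` or `t_i`. -/
theorem loopCoroot_lie_self_pos (S : CurrentSystem M x t h) (i : I) (m u : ℕ) :
    ⁅loopCoroot x i m, x .pos i u⁆ = (2 : ℤ) • x .pos i (u + m) := by
  have exchange (r s u : ℕ) : ⁅loopCoroot x i (r + s), x .pos i u⁆ =
      ⁅loopCoroot x i (u + s), x .pos i r⁆ := by
    have jacobi := leibniz_lie (x .pos i u) (x .pos i r) (x .neg i s)
    rw [S.same_node, zero_lie, zero_add] at jacobi
    rw [← S.lie_pos_neg_self, ← S.lie_pos_neg_self, ← lie_skew, jacobi, lie_skew]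
  have reduce := exchange 0 m u
  rw [zero_add] at reduce
  rw [reduce]
  rcases u + m with _ | v
  · rw [S.loopCoroot_zero, S.h_lie_self, Sgn.toInt, mul_one]
  · rw [← exchange 0 1 v, zero_add, S.loopCoroot_one, S.t_lie_self, Sgn.toInt, mul_one]

theorem loopCoroot_lie_self (S : CurrentSystem M x t h) (e : Sgn) (i : I) (m u : ℕ) :
    ⁅loopCoroot x i m, x e i u⁆ = (2 * e.toInt) • x e i (u + m) := by
  cases e
  · exact S.loopCoroot_lie_self_pos i m u
  · have key := S.chevalley.loopCoroot_lie_self_pos i m u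
    rw [S.loopCoroot_chevalley, neg_lie, neg_eq_iff_eq_neg] at key
    exact key.trans (neg_smul (2 : ℤ) _).symm

theorem loopCoroot_lie_of_far (S : CurrentSystem M x t h) (e : Sgn) {i j : I} (hij : i ≠ j)
    (ha : ¬ M.Adj i j) (hf : ¬ M.Fork i j) (m u : ℕ) : ⁅loopCoroot x i m, x e j u⁆ = 0 := by
  rw [loopCoroot, lie_lie, S.lie_eq_zero_of_far _ _ hij ha hf, S.lie_eq_zero_of_far _ _ hij ha hf,
    lie_zero, lie_zero, sub_zero]

theorem lie_loopCoroot_eq_zero (S : CurrentSystem M x t h) {j : I} {y : L} {k : ℕ} {c : ℤ}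
    (hy : ∀ e u, ⁅y, x e j u⁆ = (e.toInt * c) • x e j (u + k)) (m : ℕ) :
    ⁅y, loopCoroot x j m⁆ = 0 := by
  rw [loopCoroot, lie_lie_of_shift (hy .pos) (hy .neg), S.lie_pos_neg_self, S.lie_pos_neg_self,
    zero_add, add_zero, Sgn.toInt, Sgn.toInt]
  module

theorem t_lie_loopCoroot (S : CurrentSystem M x t h) (i j : I) (m : ℕ) :
    ⁅t i, loopCoroot x j m⁆ = 0 :=
  S.lie_loopCoroot_eq_zero (fun e u => S.t_lie e i j u) m

theorem loopCoroot_lie_of_zero (S : CurrentSystem M x t h) {e : Sgn} {i j : I} {m : ℕ} {c : ℤ}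
    (h0 : ⁅loopCoroot x i m, x e j 0⁆ = c • x e j m) (u : ℕ) :
    ⁅loopCoroot x i m, x e j u⁆ = c • x e j (u + m) := by
  induction u with
  | zero => rw [h0, zero_add]
  | succ u ih =>
    have key := congrArg (⁅t j, ·⁆) ih
    simp only [leibniz_lie (t j), S.t_lie_loopCoroot, zero_lie, zero_add, S.t_lie_self,
      lie_smul] at key
    rw [smul_comm c] at key
    rw [zsmul_right_injective (mul_ne_zero two_ne_zero e.toInt_ne_zero) key, add_right_comm]

theorem fork_zero_zero (S : CurrentSystem M x t h) (e e' : Sgn) {i j : I} (hf : M.Fork i j) :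
    ⁅x e i 0, x e' j 0⁆ = 0 :=
  S.zero_lie_zero e e' hf.ne hf.not_adj

/-- The extra relation `[H_{i,2}, x^±_{j,0}] = 0` says that `[x^e_{i,2}, x^{e'}_{j,0}]` commutes
with `x^{-e}_{i,0}`; it also commutes with `x^e_{i,0}`, hence with `h_i`. -/
theorem fork_two_zero_of (S : CurrentSystem M x t h) {i j : I} (hf : M.Fork i j)
    (hr : ∀ e, ⁅⁅x .pos i 1, x .neg i 1⁆, x e j 0⁆ = 0) (e e' : Sgn) :
    ⁅x e i 2, x e' j 0⁆ = 0 := by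
  have hr' := hr e'
  rw [S.lie_pos_neg_self, one_add_one_eq_two] at hr'
  have hcomm (f : Sgn) : ⁅x f i 0, ⁅x e i 2, x e' j 0⁆⁆ = 0 := by
    rw [leibniz_lie, S.fork_zero_zero _ _ hf, lie_zero, add_zero]
    cases f <;> cases e
    · rw [S.same_node, zero_lie]
    · rw [S.lie_pos_neg_self, zero_add, hr']
    · rw [← lie_skew (x .neg i 0), S.lie_pos_neg_self, neg_lie, add_zero, hr', neg_zero]
    · rw [S.same_node, zero_lie]
  have hh : ⁅h i, ⁅x e i 2, x e' j 0⁆⁆ = 0 := by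
    rw [← S.pos_neg, lie_lie, hcomm, hcomm, lie_zero, lie_zero, sub_zero]
  rw [leibniz_lie, S.h_lie_self, S.h_lie, hf.1, mul_zero, zero_smul, lie_zero, add_zero,
    smul_lie] at hh
  exact (smul_eq_zero_iff_right (mul_ne_zero two_ne_zero e.toInt_ne_zero)).1 hh

/-- Apply `H_{k,2}`, where `k` is a common neighbour of `i` and `j`, to
`[x^e_{i,0}, x^{e'}_{j,0}] = 0`. -/
theorem fork_two_zero_of_symm (S : CurrentSystem M x t h) {i j : I} (hf : M.Fork i j)
    {e e' : Sgn} (H : ⁅x e' j 2, x e i 0⁆ = 0) : ⁅x e i 2, x e' j 0⁆ = 0 := by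
  obtain ⟨k, hki, hkj⟩ := M.exists_adj_adj hf.1 hf.2
  have key := lie_lie_of_shift (S.loopCoroot_lie_of_adj e hki 2)
    (S.loopCoroot_lie_of_adj e' hkj 2) 0 0
  rw [S.fork_zero_zero _ _ hf, lie_zero, zero_add, ← lie_skew (x e i 0), H, neg_zero, smul_zero,
    add_zero] at key
  exact (smul_eq_zero_iff_right (neg_ne_zero.2 e.toInt_ne_zero)).1 key.symm

theorem fork_two_zero (S : CurrentSystem M x t h) (e e' : Sgn) {i j : I} (hf : M.Fork i j) :
    ⁅x e i 2, x e' j 0⁆ = 0 := by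
  rcases S.fork hf with hr | hr
  exacts [S.fork_two_zero_of hf hr e e',
    S.fork_two_zero_of_symm hf (S.fork_two_zero_of hf.symm hr e' e)]

theorem loopCoroot_two_lie_of_fork (S : CurrentSystem M x t h) (e : Sgn) {i j : I}
    (hf : M.Fork i j) (u : ℕ) : ⁅loopCoroot x i 2, x e j u⁆ = 0 := by
  rw [S.loopCoroot_lie_of_zero (c := 0), zero_smul]
  rw [loopCoroot, lie_lie, S.fork_two_zero _ _ hf, S.fork_zero_zero _ _ hf, lie_zero, lie_zero,
    sub_zero, zero_smul]

theorem fork_add_two_left (S : CurrentSystem M x t h) {e e' : Sgn} {i j : I} (hf : M.Fork i j)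
    {r s : ℕ} (H : ⁅x e i r, x e' j s⁆ = 0) : ⁅x e i (r + 2), x e' j s⁆ = 0 :=
  lie_add_eq_zero_of_shift (mul_ne_zero two_ne_zero e.toInt_ne_zero) (S.loopCoroot_lie_self e i 2)
    (S.loopCoroot_two_lie_of_fork e' hf) H

theorem fork_add_two_right (S : CurrentSystem M x t h) {e e' : Sgn} {i j : I} (hf : M.Fork i j)
    {r s : ℕ} (H : ⁅x e i r, x e' j s⁆ = 0) : ⁅x e i r, x e' j (s + 2)⁆ = 0 := by
  rw [← lie_skew, neg_eq_zero] at H ⊢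
  exact S.fork_add_two_left hf.symm H

theorem fork_one_one (S : CurrentSystem M x t h) (e e' : Sgn) {i j : I} (hf : M.Fork i j) :
    ⁅x e i 1, x e' j 1⁆ = 0 := by
  have shift := lie_lie_of_shift (S.t_lie_self e i) (S.t_lie_of_fork e' hf)
  have h02 : ⁅x e i 0, x e' j 2⁆ = 0 := S.fork_add_two_right hf (S.fork_zero_zero e e' hf)
  have key := congrArg (⁅t i, ·⁆) (shift 0 0)
  simp only [S.fork_zero_zero _ _ hf, lie_zero, lie_add, lie_smul, shift, zero_add,
    one_add_one_eq_two, S.fork_two_zero _ _ hf, h02, smul_zero, add_zero] at key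
  refine (smul_eq_zero_iff_right (r := 8 * (e.toInt * e'.toInt)) ?_).1 ?_
  · exact mul_ne_zero (by decide) (mul_ne_zero e.toInt_ne_zero e'.toInt_ne_zero)
  · linear_combination (norm := module) -key

theorem fork_even (S : CurrentSystem M x t h) (e e' : Sgn) {i j : I} (hf : M.Fork i j) :
    ∀ {r s : ℕ}, Even (r + s) → ⁅x e i r, x e' j s⁆ = 0
  | 0, 0, _ => S.fork_zero_zero e e' hf
  | 1, 1, _ => S.fork_one_one e e' hf
  | 0, 1, hrs => absurd hrs (by decide)
  | 1, 0, hrs => absurd hrs (by decide)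
  | r + 2, s, hrs => S.fork_add_two_left hf (S.fork_even e e' hf (by grind))
  | 0, s + 2, hrs => S.fork_add_two_right hf (S.fork_even e e' hf (by grind))
  | 1, s + 2, hrs => S.fork_add_two_right hf (S.fork_even e e' hf (by grind))

theorem fork_shift (S : CurrentSystem M x t h) (e e' : Sgn) {i j : I} (hf : M.Fork i j)
    (r s : ℕ) : e.toInt • ⁅x e i (r + 1), x e' j s⁆ = (-e'.toInt) • ⁅x e i r, x e' j (s + 1)⁆ := by
  by_cases hrs : Even (r + s)
  · have key := lie_lie_of_shift (S.t_lie_self e i) (S.t_lie_of_fork e' hf) r s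
    rw [S.fork_even e e' hf hrs, lie_zero] at key
    refine zsmul_right_injective (n := 2) two_ne_zero ?_
    linear_combination (norm := module) -key
  · rw [S.fork_even e e' hf (r := r + 1) (by grind), S.fork_even e e' hf (s := s + 1) (by grind),
      smul_zero, smul_zero]

theorem fork_shift_self (S : CurrentSystem M x t h) (e : Sgn) {i j : I} (hf : M.Fork i j)
    (r s : ℕ) : ⁅x e i (r + 1), x e j s⁆ = -⁅x e i r, x e j (s + 1)⁆ := by
  refine zsmul_right_injective e.toInt_ne_zero ?_
  simpa only [neg_smul, smul_neg] using S.fork_shift e e hf r s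

theorem fork_pos_neg (S : CurrentSystem M x t h) {i j : I} (hf : M.Fork i j) (r s : ℕ) :
    ⁅x .pos i r, x .neg j s⁆ = forkElement x i j (r + s) := by
  induction s generalizing r with
  | zero => rfl
  | succ s ih =>
    have shift := S.fork_shift .pos .neg hf r s
    simp only [Sgn.toInt, neg_neg, one_smul] at shift
    rw [← shift, ih, add_right_comm, add_assoc]

theorem serre_fork (S : CurrentSystem M x t h) (e : Sgn) {i j : I} (hf : M.Fork i j)
    (r : ℕ) : ⁅x e i 0, ⁅x e i 0, x e j (2 * r + 1)⁆⁆ = 0 := by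
  have shift := S.fork_shift_self e hf 0 (2 * r)
  rw [zero_add, ← neg_eq_iff_eq_neg] at shift
  rw [← shift, lie_neg, leibniz_lie, S.same_node, S.fork_even _ _ hf (by simp), lie_zero,
    zero_lie, add_zero, neg_zero]

theorem loopCoroot_lie_of_fork_even (S : CurrentSystem M x t h) (e : Sgn) {i j : I}
    (hf : M.Fork i j) {m : ℕ} (hm : Even m) (u : ℕ) : ⁅loopCoroot x i m, x e j u⁆ = 0 := by
  rw [S.loopCoroot_lie_of_zero (c := 0), zero_smul]
  rw [loopCoroot, lie_lie, S.fork_even _ _ hf (s := 0) hm, S.fork_zero_zero _ _ hf, lie_zero,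
    lie_zero, sub_zero, zero_smul]

theorem forkElement_lie_pos_eq (S : CurrentSystem M x t h) {i j : I} (hf : M.Fork i j)
    {a b r : ℕ} (har : Even (a + r)) :
    ⁅forkElement x i j (a + b), x .pos j r⁆ = ⁅loopCoroot x j (r + b), x .pos i a⁆ := by
  rw [← S.fork_pos_neg hf, lie_lie, S.fork_even _ _ hf har, lie_zero, sub_zero,
    ← lie_skew (x .neg j b), lie_neg, S.lie_pos_neg_self, lie_skew]

theorem loopCoroot_lie_of_fork_odd_pos (S : CurrentSystem M x t h) {i j : I}
    (hf : M.Fork i j) {m : ℕ} (hm : Odd m) (u : ℕ) :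
    ⁅loopCoroot x i m, x .pos j u⁆ = (2 : ℤ) • x .pos j (u + m) := by
  refine S.loopCoroot_lie_of_zero ?_ u
  obtain ⟨k, rfl⟩ := hm
  have split_zero := S.forkElement_lie_pos_eq hf.symm (a := 0) (b := 2 * k + 1) (r := 0) (by simp)
  have split_one := S.forkElement_lie_pos_eq hf.symm (a := 2 * k) (b := 1) (r := 0) (by simp)
  simp only [zero_add] at split_zero split_one
  rw [← split_zero, split_one, S.loopCoroot_one, S.t_lie_of_fork _ hf, Sgn.toInt,
    mul_one]

theorem loopCoroot_lie_of_fork_odd (S : CurrentSystem M x t h) (e : Sgn) {i j : I}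
    (hf : M.Fork i j) {m : ℕ} (hm : Odd m) (u : ℕ) :
    ⁅loopCoroot x i m, x e j u⁆ = (2 * e.toInt) • x e j (u + m) := by
  cases e
  · exact S.loopCoroot_lie_of_fork_odd_pos hf hm u
  · have key := S.chevalley.loopCoroot_lie_of_fork_odd_pos hf hm u
    rw [S.loopCoroot_chevalley, neg_lie, neg_eq_iff_eq_neg] at key
    exact key.trans (neg_smul (2 : ℤ) _).symm

theorem loopCoroot_lie (S : CurrentSystem M x t h) (e : Sgn) (i j : I) (m u : ℕ) :
    ⁅loopCoroot x i m, x e j u⁆ = (e.toInt * M.entry m i j) • x e j (u + m) := by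
  rw [ForkedCartanMatrix.entry]
  by_cases hij : i = j
  · rw [hij, S.loopCoroot_lie_self, M.even_self, M.odd_self, ite_self, mul_comm]
  by_cases ha : M.Adj i j
  · rw [S.loopCoroot_lie_of_adj _ ha, show M.even i j = -1 from ha, ha.odd_eq, ite_self,
      mul_neg_one]
  by_cases hf : M.Fork i j
  · split_ifs with hm
    · rw [S.loopCoroot_lie_of_fork_even e hf hm, hf.1, mul_zero, zero_smul]
    · rw [S.loopCoroot_lie_of_fork_odd e hf (Nat.not_even_iff_odd.1 hm), hf.2, mul_comm]
  · rw [S.loopCoroot_lie_of_far e hij ha hf, M.even_eq_zero hij ha, M.odd_eq_zero hij ha hf,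
      ite_self, mul_zero, zero_smul]

theorem loopCoroot_comm (S : CurrentSystem M x t h) (i j : I) (m k : ℕ) :
    ⁅loopCoroot x i m, loopCoroot x j k⁆ = 0 :=
  S.lie_loopCoroot_eq_zero (fun e u => S.loopCoroot_lie e i j m u) k

theorem forkElement_eq_zero (S : CurrentSystem M x t h) {i j : I} (hf : M.Fork i j) {m : ℕ}
    (hm : Even m) : forkElement x i j m = 0 :=
  S.fork_even _ _ hf (s := 0) hm

theorem forkElement_lie_pos (S : CurrentSystem M x t h) {i j : I} (hf : M.Fork i j) {m : ℕ}
    (hm : Odd m) (r : ℕ) : ⁅forkElement x i j m, x .pos j r⁆ = (2 : ℤ) • x .pos i (r + m) := by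
  obtain ⟨k, rfl⟩ := hm
  rcases Nat.even_or_odd r with hr | hr
  · have key := S.forkElement_lie_pos_eq hf (a := 0) (b := 2 * k + 1) (r := r) (by grind)
    rw [zero_add] at key
    rw [key, S.loopCoroot_lie_of_fork_odd_pos hf.symm (by grind), zero_add]
  · have key := S.forkElement_lie_pos_eq hf (a := 1) (b := 2 * k) (r := r) (by grind)
    rw [add_comm 1] at key
    rw [key, S.loopCoroot_lie_of_fork_odd_pos hf.symm (by grind), add_comm 1, add_assoc]

theorem forkElement_chevalley (S : CurrentSystem M x t h) {i j : I} (hf : M.Fork i j) (m : ℕ) :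
    forkElement (fun e => x (-e)) i j m = -forkElement x j i m := by
  rw [← zero_add m, ← S.fork_pos_neg hf.symm, lie_skew, zero_add]
  rfl

theorem forkElement_lie_neg (S : CurrentSystem M x t h) {i j : I} (hf : M.Fork i j) {m : ℕ}
    (hm : Odd m) (r : ℕ) : ⁅forkElement x i j m, x .neg i r⁆ = (-2 : ℤ) • x .neg j (r + m) := by
  have key := S.chevalley.forkElement_lie_pos hf.symm hm r
  rw [S.forkElement_chevalley hf.symm, neg_lie, neg_eq_iff_eq_neg] at key
  exact key.trans (neg_smul (2 : ℤ) _).symm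

theorem forkElement_lie_pos_self (S : CurrentSystem M x t h) {i j : I} (hf : M.Fork i j)
    (m r : ℕ) : ⁅forkElement x i j m, x .pos i r⁆ = 0 := by
  have key (a b : ℕ) (hb : Even (b + r)) : ⁅forkElement x i j (a + b), x .pos i r⁆ = 0 := by
    rw [← S.fork_pos_neg hf, lie_lie, S.same_node, ← lie_skew (x .neg j b),
      S.fork_even _ _ hf (add_comm b r ▸ hb), neg_zero, lie_zero, lie_zero, sub_zero]
  rcases Nat.even_or_odd m with hm | ⟨k, rfl⟩
  · rw [S.forkElement_eq_zero hf hm, zero_lie]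
  rcases Nat.even_or_odd r with hr | hr
  · exact key _ 0 (by simpa using hr)
  · exact key (2 * k) 1 (by grind)

theorem forkElement_lie_neg_self (S : CurrentSystem M x t h) {i j : I} (hf : M.Fork i j)
    (m r : ℕ) : ⁅forkElement x i j m, x .neg j r⁆ = 0 := by
  have key := S.chevalley.forkElement_lie_pos_self hf.symm m r
  rwa [S.forkElement_chevalley hf.symm, neg_lie, neg_eq_zero] at key

theorem forkElement_lie_forkElement (S : CurrentSystem M x t h) {i j : I} (hf : M.Fork i j)
    (m k : ℕ) : ⁅forkElement x i j m, forkElement x i j k⁆ = 0 := by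
  rw [forkElement.eq_def x i j k, leibniz_lie, S.forkElement_lie_pos_self hf,
    S.forkElement_lie_neg_self hf, lie_zero, zero_lie, add_zero]

theorem loopCoroot_eq_of_fork (S : CurrentSystem M x t h) {i j : I} (hf : M.Fork i j)
    {m : ℕ} (hm : Odd m) : loopCoroot x i m = loopCoroot x j m := by
  have key := leibniz_lie (forkElement x i j m) (x .pos j 0) (x .neg i 0)
  rw [S.fork_zero_zero _ _ hf.symm, lie_zero, S.forkElement_lie_pos hf hm,
    S.forkElement_lie_neg hf hm, smul_lie, lie_smul, S.lie_pos_neg_self, S.lie_pos_neg_self,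
    add_zero, zero_add, zero_add] at key
  refine zsmul_right_injective (n := 2) two_ne_zero ?_
  linear_combination (norm := module) -key

theorem forkElement_lie_pos_of_adj (S : CurrentSystem M x t h) {i j k : I} (hf : M.Fork i j)
    (hi : M.Adj k i) (hj : M.Adj k j) (m r : ℕ) : ⁅forkElement x i j m, x .pos k r⁆ = 0 := by
  have hkj (a b : ℕ) : ⁅x .pos k a, x .neg j b⁆ = 0 := S.pos_neg_eq_zero hj.ne hj.not_fork a b
  rw [← lie_skew, neg_eq_zero, forkElement, leibniz_lie, hkj, lie_zero, add_zero,
    S.lie_of_adj _ hi, ← zero_add (m + r), ← S.lie_of_adj _ hi, lie_lie,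
    S.fork_zero_zero _ _ hf, hkj, lie_zero, lie_zero, sub_zero]

theorem forkElement_lie_of_adj (S : CurrentSystem M x t h) (e : Sgn) {i j k : I}
    (hf : M.Fork i j) (hi : M.Adj k i) (hj : M.Adj k j) (m r : ℕ) :
    ⁅forkElement x i j m, x e k r⁆ = 0 := by
  cases e
  · exact S.forkElement_lie_pos_of_adj hf hi hj m r
  · have key := S.chevalley.forkElement_lie_pos_of_adj hf.symm hj hi m r
    rwa [S.forkElement_chevalley hf.symm, neg_lie, neg_eq_zero] at key

theorem forkElement_lie_of_far (S : CurrentSystem M x t h) (e : Sgn) {i j k : I}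
    (hi : k ≠ i) (hj : k ≠ j) (ai : ¬ M.Adj k i) (aj : ¬ M.Adj k j) (fi : ¬ M.Fork k i)
    (fj : ¬ M.Fork k j) (m r : ℕ) : ⁅forkElement x i j m, x e k r⁆ = 0 := by
  rw [← lie_skew, neg_eq_zero, forkElement, leibniz_lie, S.lie_eq_zero_of_far _ _ hi ai fi,
    S.lie_eq_zero_of_far _ _ hj aj fj, lie_zero, zero_lie, zero_add]

end CurrentSystem

end CurrentSystem

/-- The nodes `0, …, n` of the Dynkin diagram. -/
abbrev Node (n : ℕ) : Type := {i : ℤ // 0 ≤ i ∧ i ≤ (n : ℤ)}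

/-- The node `k` with `1 ≤ k ≤ n - 1` whose generators `H_{k,r}` of odd degree `r` are assigned to
the node `i`: the nodes `0` and `n` have none of their own. -/
def foldNode (n : ℕ) (i : ℤ) : ℤ := if i = 0 then 1 else if i = n then (n : ℤ) - 1 else i

theorem foldNode_mem {n : ℕ} (hn : 4 ≤ n) {i : ℤ} (hi : 0 ≤ i ∧ i ≤ (n : ℤ)) :
    1 ≤ foldNode n i ∧ foldNode n i ≤ (n : ℤ) - 1 := by
  unfold foldNode
  grind

theorem foldNode_of_mem {n : ℕ} {i : ℤ} (hi : 1 ≤ i ∧ i ≤ (n : ℤ) - 1) : foldNode n i = i := by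
  unfold foldNode
  grind

theorem isFork_comm {n : ℕ} {i j : ℤ} : IsFork n i j ↔ IsFork n j i := by
  unfold IsFork
  omega

theorem cartanEven_comm (n : ℕ) (i j : ℤ) : cartanEven n i j = cartanEven n j i := by
  unfold cartanEven
  grind

theorem IsFork.cartanEven_eq_zero {n : ℕ} (hn : 4 ≤ n) {i j : ℤ} (hf : IsFork n i j) :
    cartanEven n i j = 0 := by
  unfold IsFork at hf
  unfold cartanEven
  grind

open Classical in
theorem cartanOdd_foldNode {n : ℕ} (hn : 4 ≤ n) {i j : ℤ} (hj : 0 ≤ j ∧ j ≤ (n : ℤ)) :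
    cartanOdd n (foldNode n i) j = if IsFork n i j then 2 else cartanEven n i j := by
  unfold foldNode
  split_ifs with h₀ hn' <;> unfold cartanOdd IsFork cartanEven at * <;> grind

theorem cartanOdd_foldNode_self {n : ℕ} (hn : 4 ≤ n) {i : ℤ} (hi : 0 ≤ i ∧ i ≤ (n : ℤ)) :
    cartanOdd n (foldNode n i) i = 2 := by
  rw [cartanOdd_foldNode hn hi, cartanEven, if_pos rfl, ite_self]

theorem validMinH_foldNode {n : ℕ} (hn : 4 ≤ n) {i : ℤ} (hi : 0 ≤ i ∧ i ≤ (n : ℤ)) :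
    ValidMinH n (foldNode n i) 1 :=
  .inr ⟨(foldNode_mem hn hi).1, (foldNode_mem hn hi).2, rfl⟩

theorem exists_cartanEven_eq_neg_one {n : ℕ} (hn : 4 ≤ n) (i : Node n) :
    ∃ j : Node n, cartanEven n i j = -1 := by
  obtain ⟨i, hi⟩ := i
  unfold cartanEven
  by_cases hi₁ : i ≤ 1
  · exact ⟨⟨2, by omega⟩, by grind⟩
  by_cases hi₂ : i ≤ (n : ℤ) - 2
  · exact ⟨⟨i + 1, by omega⟩, by grind⟩
  · exact ⟨⟨(n : ℤ) - 2, by omega⟩, by grind⟩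

theorem IsFork.exists_cartanEven_eq_neg_one {n : ℕ} (hn : 4 ≤ n) {i j : ℤ} (hf : IsFork n i j) :
    ∃ k : Node n, cartanEven n k i = -1 ∧ cartanEven n k j = -1 := by
  unfold IsFork at hf
  unfold cartanEven
  by_cases hi : i ≤ 1
  · exact ⟨⟨2, by omega⟩, by grind, by grind⟩
  · exact ⟨⟨(n : ℤ) - 2, by omega⟩, by grind, by grind⟩

open Classical in
/-- The matrices of the presentation of `D(2n)`. The matrix `cartanOdd` has rows
`1, …, n - 1` only; row `i` of the odd matrix here is its row `foldNode n i`, see `affineD_odd`. -/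
noncomputable def affineD (n : ℕ) (hn : 4 ≤ n) : ForkedCartanMatrix (Node n) where
  even i j := cartanEven n i j
  odd i j := if IsFork n i j then 2 else cartanEven n i j
  even_self i := if_pos rfl
  odd_self i := by simp [cartanEven]
  even_symm i j := cartanEven_comm n i j
  odd_symm i j := by rw [cartanEven_comm]; exact if_congr isFork_comm rfl rfl
  even_odd_of_ne {i j} hij := by
    rw [Ne, Subtype.ext_iff] at hij
    by_cases hf : IsFork n i j
    · exact .inr (.inr ⟨hf.cartanEven_eq_zero hn, if_pos hf⟩)
    · rw [if_neg hf]
      unfold cartanEven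
      grind
  exists_adj := exists_cartanEven_eq_neg_one hn
  exists_adj_adj {i j} h₀ h₂ := by
    refine IsFork.exists_cartanEven_eq_neg_one hn (by_contra fun hf : ¬ IsFork n i j => ?_)
    rw [if_neg hf, h₀] at h₂
    omega

theorem affineD_odd {n : ℕ} {hn : 4 ≤ n} (i j : Node n) :
    (affineD n hn).odd i j = cartanOdd n (foldNode n i) j :=
  (cartanOdd_foldNode hn j.2).symm

theorem affineD_fork_iff {n : ℕ} {hn : 4 ≤ n} {i j : Node n} :
    (affineD n hn).Fork i j ↔ IsFork n i j := by
  refine ⟨fun hf => by_contra fun hij => ?_, fun hf => ⟨hf.cartanEven_eq_zero hn, if_pos hf⟩⟩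
  have := (if_neg hij).symm.trans hf.2
  have : cartanEven n i j = 0 := hf.1
  omega

theorem ValidH.mem {n : ℕ} {i : ℤ} {r : ℕ} (hn : 4 ≤ n) (hi : ValidH n i r) :
    0 ≤ i ∧ i ≤ (n : ℤ) := by
  unfold ValidH at hi
  omega

theorem validH_of_even {n : ℕ} {i : ℤ} {r : ℕ} (hi : 0 ≤ i ∧ i ≤ (n : ℤ)) (hr : Even r) :
    ValidH n i r := by
  by_cases hi' : 1 ≤ i ∧ i ≤ (n : ℤ) - 1
  exacts [.inl hi', .inr ⟨by omega, hr⟩]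

theorem DFree.coroot_of_even {n : ℕ} (i : ℤ) {m : ℕ} (hm : Even m) :
    DFree.coroot n i m = DFree.H n i m :=
  if_pos hm

theorem DFree.coroot_of_odd {n : ℕ} (i : ℤ) {m : ℕ} (hm : Odd m) :
    DFree.coroot n i m = DFree.H n (foldNode n i) m := by
  rw [DFree.coroot, if_neg (Nat.not_even_iff_odd.2 hm), foldNode]
  split_ifs <;> rfl

theorem DFree.coroot_of_validH {n : ℕ} {i : ℤ} {m : ℕ} (hi : ValidH n i m) :
    DFree.coroot n i m = DFree.H n i m := by
  rcases m.even_or_odd with hm | hm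
  · exact DFree.coroot_of_even i hm
  · have hi' := hi.resolve_right fun h => Nat.not_even_iff_odd.2 hm h.2
    rw [DFree.coroot_of_odd i hm, foldNode_of_mem hi']

theorem affineD_entry {n : ℕ} {hn : 4 ≤ n} {i j : Node n} {r : ℕ} (hi : ValidH n i r) :
    (affineD n hn).entry r i j = cartan n r i j := by
  unfold ForkedCartanMatrix.entry cartan
  split_ifs with hr
  · rfl
  · rw [affineD_odd, foldNode_of_mem (hi.resolve_right fun h => hr h.2)]

theorem mem_of_mem_rootWord {n : ℕ} {i : ℤ} (hi : i ∈ rootWord n) :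
    0 ≤ i ∧ i ≤ (n : ℤ) := by
  simp only [rootWord, List.pure_def, List.bind_eq_flatMap, List.mem_map, List.mem_flatMap,
    List.mem_append, List.mem_reverse, List.mem_range'_1, List.mem_singleton] at hi
  grind

theorem rootVector_congr {n : ℕ} {L : Type} [AddCommGroup L] [Bracket L L] {x y : ℤ → L}
    (hxy : ∀ i, 0 ≤ i ∧ i ≤ (n : ℤ) → x i = y i) : rootVector n x = rootVector n y := by
  unfold rootVector
  rw [hxy 0 (by omega)]
  congr 1
  exact List.foldr_ext _ _ _ fun i hi z => by rw [hxy i (mem_of_mem_rootWord hi)]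

theorem loopCartan_congr {n : ℕ} {L : Type} [AddCommGroup L] [Bracket L L] [Module ℂ L]
    (hn : 1 ≤ n) {xp xm yp ym : ℤ → L}
    (hp : ∀ i, 0 ≤ i ∧ i ≤ (n : ℤ) → xp i = yp i) (hm : ∀ i, 0 ≤ i ∧ i ≤ (n : ℤ) → xm i = ym i)
    (u : ℤ) : loopCartan n xp xm u = loopCartan n yp ym u := by
  unfold loopCartan
  rw [rootVector_congr hp, rootVector_congr hm, hp 1 (by omega), hm 1 (by omega)]

section LoopCartan

variable {L L' : Type} [LieRing L] [LieAlgebra ℂ L] [LieRing L'] [LieAlgebra ℂ L']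

theorem map_rootVector (f : L →ₗ⁅ℂ⁆ L') (n : ℕ) (x : ℤ → L) :
    f (rootVector n x) = rootVector n fun i => f (x i) := by
  unfold rootVector
  rw [map_zsmul]
  congr 1
  induction rootWord n with
  | nil => rfl
  | cons a l ih => rw [List.foldr_cons, List.foldr_cons, LieHom.map_lie, ih]

theorem map_halfAdIter (f : L →ₗ⁅ℂ⁆ L') (h e : L) (k : ℕ) :
    f (halfAdIter h e k) = halfAdIter (f h) (f e) k := by
  induction k with
  | zero => rfl
  | succ k ih => rw [halfAdIter, halfAdIter, map_smul, LieHom.map_lie, ih]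

theorem map_loopCartan (f : L →ₗ⁅ℂ⁆ L') (n : ℕ) (xp xm : ℤ → L) (u : ℤ) :
    f (loopCartan n xp xm u) = loopCartan n (fun i => f (xp i)) (fun i => f (xm i)) u := by
  unfold loopCartan
  rw [LieHom.map_lie, map_halfAdIter]
  split_ifs <;> simp only [LieHom.map_lie, map_rootVector]

end LoopCartan

namespace DMin

attribute [local instance] LieRing.ofAssociativeRing

variable {n : ℕ}

/-- The projection from the free algebra, as a homomorphism for the commutator brackets. -/
noncomputable def mk (n : ℕ) : MinFree n →ₗ⁅ℂ⁆ DMin n := (RingQuot.mkAlgHom ℂ (MinRel n)).toLieHom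

theorem mk_h (i : ℤ) (r : ℕ) : mk n (MinFree.h n i r) = h n i r := rfl

theorem mk_x (e : Sgn) (i : ℤ) (r : ℕ) : mk n (MinFree.x n e i r) = x n e i r := rfl

theorem mk_eq_of_rel {a b : MinFree n} (hab : MinRel n a b) : mk n a = mk n b :=
  RingQuot.mkAlgHom_rel ℂ hab

theorem h_lie_h {i j : ℤ} {r s : ℕ} (hi : ValidMinH n i r) (hj : ValidMinH n j s) :
    ⁅h n i r, h n j s⁆ = 0 := by
  simpa only [LieHom.map_lie, map_zero, mk_h] using mk_eq_of_rel (.hh i j r s hi hj)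

theorem h_lie_x (e : Sgn) {i j : ℤ} {r : ℕ} (hi : ValidMinH n i r) (hj : 0 ≤ j ∧ j ≤ (n : ℤ)) :
    ⁅h n i r, x n e j 0⁆ = (e.toInt * cartan n r i j) • x n e j r := by
  simpa only [LieHom.map_lie, map_zsmul, mk_h, mk_x] using mk_eq_of_rel (.hx e i j r hi hj)

theorem x_pos_one_lie_x_neg {i : ℤ} (hi : 0 ≤ i ∧ i ≤ (n : ℤ)) :
    ⁅x n .pos i 1, x n .neg i 0⁆ = h n (foldNode n i) 1 := by
  unfold foldNode
  split_ifs with h₀ hₙ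
  · simpa only [LieHom.map_lie, mk_h, mk_x, h₀] using mk_eq_of_rel (n := n) .xx_one_zero
  · simpa only [LieHom.map_lie, mk_h, mk_x, hₙ] using mk_eq_of_rel (n := n) .xx_one_last
  · simpa only [LieHom.map_lie, mk_h, mk_x] using mk_eq_of_rel (.xx_one_mid i (by omega))

theorem fork_lie_eq_zero {i j : ℤ} (hf : IsFork n i j) :
    (∀ e, ⁅⁅x n .pos i 1, x n .neg i 1⁆, x n e j 0⁆ = 0) ∨
      (∀ e, ⁅⁅x n .pos j 1, x n .neg j 1⁆, x n e i 0⁆ = 0) := by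
  have zero_one (e : Sgn) : ⁅⁅x n .pos 0 1, x n .neg 0 1⁆, x n e 1 0⁆ = 0 := by
    simpa only [LieHom.map_lie, map_zero, mk_x] using mk_eq_of_rel (.fork_zero e)
  have pred_last (e : Sgn) : ⁅⁅x n .pos (n - 1) 1, x n .neg (n - 1) 1⁆, x n e n 0⁆ = 0 := by
    simpa only [LieHom.map_lie, map_zero, mk_x] using mk_eq_of_rel (.fork_last e)
  rcases hf with ⟨rfl, rfl⟩ | ⟨rfl, rfl⟩ | ⟨rfl, rfl⟩ | ⟨rfl, rfl⟩
  exacts [.inl zero_one, .inr zero_one, .inl pred_last, .inr pred_last]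

/-- The elements `x^±_{i,r}` of arbitrary degree `r`, defined recursively by the relation
`[h_{i,1}, x^±_{i,r}] = ± 2 x^±_{i,r+1}`. -/
noncomputable def loopX (n : ℕ) (e : Sgn) (i : ℤ) : ℕ → DMin n
  | 0 => x n e i 0
  | r + 1 => ((e.toInt : ℂ) / 2) • ⁅h n (foldNode n i) 1, loopX n e i r⁆

theorem loopX_of_le_one (hn : 4 ≤ n) (e : Sgn) {i : ℤ} (hi : 0 ≤ i ∧ i ≤ (n : ℤ)) {r : ℕ}
    (hr : r ≤ 1) : loopX n e i r = x n e i r := by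
  interval_cases r
  · rfl
  rw [loopX, loopX, h_lie_x e (validMinH_foldNode hn hi) hi, cartan, if_neg (by decide),
    cartanOdd_foldNode_self hn hi, ← Int.cast_smul_eq_zsmul ℂ, smul_smul]
  cases e <;> norm_num [Sgn.toInt]

theorem h_lie_loopX (hn : 4 ≤ n) (e : Sgn) {i j : ℤ} {d : ℕ} (hi : ValidMinH n i d)
    (hj : 0 ≤ j ∧ j ≤ (n : ℤ)) (r : ℕ) :
    ⁅h n i d, loopX n e j r⁆ = (e.toInt * cartan n d i j) • loopX n e j (r + d) := by
  induction r with
  | zero =>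
    have hd : d ≤ 1 := by
      unfold ValidMinH at hi
      omega
    rw [zero_add, loopX, h_lie_x e hi hj, loopX_of_le_one hn e hj hd]
  | succ r ih =>
    have pull_scalar : ⁅h n i d, loopX n e j (r + 1)⁆ =
        ((e.toInt : ℂ) / 2) • ⁅h n i d, ⁅h n (foldNode n j) 1, loopX n e j r⁆⁆ := by
      rw [loopX]
      exact lie_smul ((e.toInt : ℂ) / 2) (h n i d) (_ : DMin n)
    rw [pull_scalar, leibniz_lie, h_lie_h hi (validMinH_foldNode hn hj), zero_lie, zero_add, ih,
      lie_zsmul, smul_comm, Nat.add_right_comm, loopX]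

theorem currentSystem (hn : 4 ≤ n) :
    CurrentSystem (affineD n hn) (fun e (i : Node n) r => loopX n e i r)
      (fun i => h n (foldNode n i) 1) (fun i => h n i 0) where
  t_lie e i j r := by
    rw [h_lie_loopX hn e (validMinH_foldNode hn i.2) j.2, affineD_odd]
    rfl
  h_lie e i j r := h_lie_loopX hn e (.inl ⟨i.2.1, i.2.2, rfl⟩) j.2 r
  t_t i j := h_lie_h (validMinH_foldNode hn i.2) (validMinH_foldNode hn j.2)
  t_h i j := h_lie_h (validMinH_foldNode hn i.2) (.inl ⟨j.2.1, j.2.2, rfl⟩)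
  pos_neg i := by
    simpa only [LieHom.map_lie, mk_h, mk_x, loopX] using mk_eq_of_rel (.xx_same i i.2)
  pos_one_neg i := by
    rw [loopX_of_le_one hn _ i.2 le_rfl]
    exact x_pos_one_lie_x_neg i.2
  pos_neg_of_ne {i j} hij := by
    simpa only [LieHom.map_lie, map_zero, mk_x, loopX] using
      mk_eq_of_rel (.xx_diff i j i.2 j.2 (Subtype.coe_ne_coe.2 hij))
  one_zero e i := by
    rw [loopX_of_le_one hn _ i.2 le_rfl]
    simpa only [LieHom.map_lie, map_zero, mk_x, loopX] using mk_eq_of_rel (.same_node e i i.2)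
  serre_two e i j ha := by
    simpa only [LieHom.map_lie, map_zero, mk_x, loopX] using
      mk_eq_of_rel (.serre_two e i j i.2 j.2 ha)
  serre_three e i j ha := by
    simpa only [LieHom.map_lie, map_zero, mk_x, loopX] using
      mk_eq_of_rel (.serre_three e i j i.2 j.2 ha)
  fork {i j} hf := by
    simp only [loopX_of_le_one hn _ i.2 le_rfl, loopX_of_le_one hn _ j.2 le_rfl]
    exact fork_lie_eq_zero (affineD_fork_iff.1 hf)

end DMin

/-- `ForkLabel n e k i j` says that the generators `X^e_{k,m}` with `k ∈ {-1, n + 1}` are those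
attached to the fork pair `(i, j)`: `[X^+_{i,r}, X^-_{j,s}] = -X^e_{k,r+s}` for odd `r + s`. -/
inductive ForkLabel (n : ℕ) : Sgn → ℤ → ℤ → ℤ → Prop
  | start_pos : ForkLabel n .pos (-1) 0 1
  | start_neg : ForkLabel n .neg (-1) 1 0
  | end_pos : ForkLabel n .pos (n + 1) n (n - 1)
  | end_neg : ForkLabel n .neg (n + 1) (n - 1) n

theorem ForkLabel.isFork {n : ℕ} {e : Sgn} {k i j : ℤ} (hl : ForkLabel n e k i j) :
    IsFork n i j := by
  cases hl <;> simp [IsFork]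

theorem IsFork.exists_forkLabel {n : ℕ} {i j : ℤ} (hf : IsFork n i j) :
    ∃ e k, ForkLabel n e k i j := by
  rcases hf with ⟨rfl, rfl⟩ | ⟨rfl, rfl⟩ | ⟨rfl, rfl⟩ | ⟨rfl, rfl⟩
  exacts [⟨_, _, .start_pos⟩, ⟨_, _, .start_neg⟩, ⟨_, _, .end_neg⟩, ⟨_, _, .end_pos⟩]

theorem exists_forkLabel_start (n : ℕ) (e : Sgn) :
    ∃ i j, ForkLabel n e (-1) i j ∧ i ≤ 1 ∧ j ≤ 1 := by
  cases e
  exacts [⟨0, 1, .start_pos, by simp⟩, ⟨1, 0, .start_neg, by simp⟩]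

theorem exists_forkLabel_end (n : ℕ) (e : Sgn) :
    ∃ i j, ForkLabel n e (n + 1) i j ∧ (n : ℤ) - 1 ≤ i ∧ (n : ℤ) - 1 ≤ j := by
  cases e
  exacts [⟨n, n - 1, .end_pos, by simp⟩, ⟨n - 1, n, .end_neg, by simp⟩]

theorem IsFork.left_mem {n : ℕ} (hn : 4 ≤ n) {i j : ℤ} (hf : IsFork n i j) :
    0 ≤ i ∧ i ≤ (n : ℤ) := by
  unfold IsFork at hf
  omega

theorem IsFork.right_mem {n : ℕ} (hn : 4 ≤ n) {i j : ℤ} (hf : IsFork n i j) :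
    0 ≤ j ∧ j ≤ (n : ℤ) :=
  (isFork_comm.1 hf).left_mem hn

theorem IsFork.cartanEven_eq {n : ℕ} (hn : 4 ≤ n) {i j k : ℤ} (hf : IsFork n i j) (hi : k ≠ i)
    (hj : k ≠ j) : cartanEven n k i = cartanEven n k j := by
  unfold cartanEven
  rcases hf with ⟨rfl, rfl⟩ | ⟨rfl, rfl⟩ | ⟨rfl, rfl⟩ | ⟨rfl, rfl⟩ <;> grind

theorem IsFork.not_isFork {n : ℕ} (hn : 4 ≤ n) {i j k : ℤ} (hf : IsFork n i j) (hj : k ≠ j) :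
    ¬ IsFork n k i := by
  unfold IsFork at *
  omega

section FreeLift

variable {n : ℕ} {L : Type} [LieRing L] [LieAlgebra ℂ L] {y : Sgn → ℤ → ℕ → L}

/-- The elements `y^±_{i,r}`, extended to `i ∈ {-1, n + 1}` as prescribed by `ForkLabel`. -/
def extendX (n : ℕ) (y : Sgn → ℤ → ℕ → L) (e : Sgn) (k : ℤ) (r : ℕ) : L :=
  if k = -1 then
    match e with
    | .pos => -forkElement y 0 1 r
    | .neg => -forkElement y 1 0 r
  else if k = n + 1 then
    match e with
    | .pos => -forkElement y n (n - 1) r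
    | .neg => -forkElement y (n - 1) n r
  else y e k r

/-- The homomorphism which sends `X^±_{i,r}` to `y^±_{i,r}` for `0 ≤ i ≤ n`, and the other
generators to the elements which the relations of `D(2n)` force upon them. -/
noncomputable def freeLift (n : ℕ) (y : Sgn → ℤ → ℕ → L) : DFree n →ₗ⁅ℂ⁆ L :=
  FreeLieAlgebra.lift ℂ fun
    | .H i r _ => loopCoroot y i r
    | .X e k r _ => extendX n y e k r

theorem freeLift_H {i : ℤ} {r : ℕ} (hi : ValidH n i r) :
    freeLift n y (DFree.H n i r) = loopCoroot y i r := by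
  rw [DFree.H, dif_pos hi, freeLift, FreeLieAlgebra.lift_of_apply]

theorem freeLift_X_of_valid (e : Sgn) {k : ℤ} {r : ℕ} (hk : ValidX n k r) :
    freeLift n y (DFree.X n e k r) = extendX n y e k r := by
  rw [DFree.X, dif_pos hk, freeLift, FreeLieAlgebra.lift_of_apply]

theorem freeLift_X (e : Sgn) {i : ℤ} (hi : 0 ≤ i ∧ i ≤ (n : ℤ)) (r : ℕ) :
    freeLift n y (DFree.X n e i r) = y e i r := by
  rw [freeLift_X_of_valid e (.inl hi), extendX.eq_def, if_neg (by omega), if_neg (by omega)]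

theorem freeLift_X_of_forkLabel {e : Sgn} {k i j : ℤ} (hl : ForkLabel n e k i j) {r : ℕ}
    (hr : Odd r) : freeLift n y (DFree.X n e k r) = -forkElement y i j r := by
  cases hl
  · rw [freeLift_X_of_valid _ (.inr ⟨.inl rfl, hr⟩), extendX, if_pos rfl]
  · rw [freeLift_X_of_valid _ (.inr ⟨.inl rfl, hr⟩), extendX, if_pos rfl]
  · rw [freeLift_X_of_valid _ (.inr ⟨.inr rfl, hr⟩), extendX, if_neg (by omega), if_pos rfl]
  · rw [freeLift_X_of_valid _ (.inr ⟨.inr rfl, hr⟩), extendX, if_neg (by omega), if_pos rfl]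

end FreeLift

namespace CurrentSystem

variable {n : ℕ} {hn : 4 ≤ n} {L : Type} [LieRing L] [LieAlgebra ℂ L] [IsAddTorsionFree L]
  {y : Sgn → ℤ → ℕ → L} {t h : Node n → L}
  (S : CurrentSystem (affineD n hn) (fun e (i : Node n) r => y e i r) t h)
  {e : Sgn} {i j k : ℤ}

include S

theorem freeLift_H_lie_H {r s : ℕ} (hi : ValidH n i r) (hj : ValidH n j s) :
    freeLift n y ⁅DFree.H n i r, DFree.H n j s⁆ = freeLift n y 0 := by
  rw [LieHom.map_lie, freeLift_H hi, freeLift_H hj, map_zero]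
  exact S.loopCoroot_comm ⟨i, hi.mem hn⟩ ⟨j, hj.mem hn⟩ r s

theorem freeLift_H_lie_X (e : Sgn) {r : ℕ} (hi : ValidH n i r) (hj : 0 ≤ j ∧ j ≤ (n : ℤ)) (s : ℕ) :
    freeLift n y ⁅DFree.H n i r, DFree.X n e j s⁆ =
      freeLift n y ((e.toInt * cartan n r i j) • DFree.X n e j (r + s)) := by
  rw [LieHom.map_lie, map_zsmul, freeLift_H hi, freeLift_X e hj, freeLift_X e hj, add_comm r s]
  refine (S.loopCoroot_lie e ⟨i, hi.mem hn⟩ ⟨j, hj⟩ r s).trans ?_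
  rw [affineD_entry hi]

theorem freeLift_coroot (hi : 0 ≤ i ∧ i ≤ (n : ℤ)) (m : ℕ) :
    freeLift n y (DFree.coroot n i m) = loopCoroot y i m := by
  rcases m.even_or_odd with hm | hm
  · rw [DFree.coroot_of_even i hm, freeLift_H (validH_of_even hi hm)]
  · rw [DFree.coroot_of_odd i hm, freeLift_H (.inl (foldNode_mem hn hi)), foldNode]
    split_ifs with h₀ hₙ
    · subst h₀
      exact S.loopCoroot_eq_of_fork (i := ⟨1, by omega⟩) (j := ⟨0, hi⟩)
        (affineD_fork_iff.2 (by simp [IsFork])) hm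
    · subst hₙ
      exact S.loopCoroot_eq_of_fork (i := ⟨(n : ℤ) - 1, by omega⟩) (j := ⟨n, hi⟩)
        (affineD_fork_iff.2 (by simp [IsFork])) hm
    · rfl

theorem freeLift_X_pos_lie_X_neg_self (hi : 0 ≤ i ∧ i ≤ (n : ℤ)) (r s : ℕ) :
    freeLift n y ⁅DFree.X n .pos i r, DFree.X n .neg i s⁆ =
      freeLift n y (DFree.coroot n i (r + s)) := by
  rw [LieHom.map_lie, freeLift_X _ hi, freeLift_X _ hi, S.freeLift_coroot hi]
  exact S.lie_pos_neg_self ⟨i, hi⟩ r s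

theorem freeLift_X_pos_lie_X_neg (hi : 0 ≤ i ∧ i ≤ (n : ℤ)) (hj : 0 ≤ j ∧ j ≤ (n : ℤ))
    (hij : i ≠ j) (hf : ¬ IsFork n i j) (r s : ℕ) :
    freeLift n y ⁅DFree.X n .pos i r, DFree.X n .neg j s⁆ = freeLift n y 0 := by
  rw [LieHom.map_lie, freeLift_X _ hi, freeLift_X _ hj, map_zero]
  exact S.pos_neg_eq_zero (i := ⟨i, hi⟩) (j := ⟨j, hj⟩) (Subtype.coe_ne_coe.1 hij)
    (affineD_fork_iff.not.2 hf) r s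

theorem freeLift_negOdd (hl : ForkLabel n e k i j) (r s : ℕ) :
    freeLift n y ⁅DFree.X n .pos i r, DFree.X n .neg j s⁆ =
      freeLift n y (DFree.negOdd n e k (r + s)) := by
  have hi := hl.isFork.left_mem hn
  have hj := hl.isFork.right_mem hn
  have hf : (affineD n hn).Fork ⟨i, hi⟩ ⟨j, hj⟩ := affineD_fork_iff.2 hl.isFork
  rw [LieHom.map_lie, freeLift_X _ hi, freeLift_X _ hj, DFree.negOdd]
  split_ifs with hrs
  · rw [map_neg, freeLift_X_of_forkLabel hl hrs, neg_neg]
    exact S.fork_pos_neg hf r s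
  · rw [map_zero]
    exact S.fork_even .pos .neg hf (Nat.not_odd_iff_even.1 hrs)

theorem freeLift_X_pos_lie_X_fork (hl : ForkLabel n e k i j) {s : ℕ} (hs : Odd s) (r : ℕ) :
    freeLift n y ⁅DFree.X n .pos j r, DFree.X n e k s⁆ =
      freeLift n y ((2 : ℤ) • DFree.X n .pos i (r + s)) := by
  have hi := hl.isFork.left_mem hn
  have hj := hl.isFork.right_mem hn
  rw [LieHom.map_lie, map_zsmul, freeLift_X _ hi, freeLift_X _ hj, freeLift_X_of_forkLabel hl hs,
    lie_neg, lie_skew]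
  exact S.forkElement_lie_pos (i := ⟨i, hi⟩) (j := ⟨j, hj⟩) (affineD_fork_iff.2 hl.isFork) hs r

theorem freeLift_X_neg_lie_X_fork (hl : ForkLabel n e k i j) {s : ℕ} (hs : Odd s) (r : ℕ) :
    freeLift n y ⁅DFree.X n .neg i r, DFree.X n e k s⁆ =
      freeLift n y ((-2 : ℤ) • DFree.X n .neg j (r + s)) := by
  have hi := hl.isFork.left_mem hn
  have hj := hl.isFork.right_mem hn
  rw [LieHom.map_lie, map_zsmul, freeLift_X _ hi, freeLift_X _ hj, freeLift_X_of_forkLabel hl hs,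
    lie_neg, lie_skew]
  exact S.forkElement_lie_neg (i := ⟨i, hi⟩) (j := ⟨j, hj⟩) (affineD_fork_iff.2 hl.isFork) hs r

theorem freeLift_X_pos_lie_X_fork_self (hl : ForkLabel n e k i j) {s : ℕ} (hs : Odd s) (r : ℕ) :
    freeLift n y ⁅DFree.X n .pos i r, DFree.X n e k s⁆ = freeLift n y 0 := by
  have hi := hl.isFork.left_mem hn
  have hj := hl.isFork.right_mem hn
  rw [LieHom.map_lie, map_zero, freeLift_X _ hi, freeLift_X_of_forkLabel hl hs, lie_neg, lie_skew]
  exact S.forkElement_lie_pos_self (i := ⟨i, hi⟩) (j := ⟨j, hj⟩) (affineD_fork_iff.2 hl.isFork) s r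

theorem freeLift_X_neg_lie_X_fork_self (hl : ForkLabel n e k i j) {s : ℕ} (hs : Odd s) (r : ℕ) :
    freeLift n y ⁅DFree.X n .neg j r, DFree.X n e k s⁆ = freeLift n y 0 := by
  have hi := hl.isFork.left_mem hn
  have hj := hl.isFork.right_mem hn
  rw [LieHom.map_lie, map_zero, freeLift_X _ hj, freeLift_X_of_forkLabel hl hs, lie_neg, lie_skew]
  exact S.forkElement_lie_neg_self (i := ⟨i, hi⟩) (j := ⟨j, hj⟩) (affineD_fork_iff.2 hl.isFork) s r

omit [LieAlgebra ℂ L] in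
theorem lie_forkElement_eq_zero (e : Sgn) (hf : IsFork n i j) (hk : 0 ≤ k ∧ k ≤ (n : ℤ))
    (hki : k ≠ i) (hkj : k ≠ j) (r s : ℕ) : ⁅y e k r, forkElement y i j s⁆ = 0 := by
  have hi := hf.left_mem hn
  have hj := hf.right_mem hn
  rw [← lie_skew, neg_eq_zero]
  by_cases ha : (affineD n hn).Adj ⟨k, hk⟩ ⟨i, hi⟩
  · exact S.forkElement_lie_of_adj (i := ⟨i, hi⟩) (j := ⟨j, hj⟩) (k := ⟨k, hk⟩) e
      (affineD_fork_iff.2 hf) ha ((hf.cartanEven_eq hn hki hkj).symm.trans ha) s r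
  · refine S.forkElement_lie_of_far (i := ⟨i, hi⟩) (j := ⟨j, hj⟩) (k := ⟨k, hk⟩) e
      (Subtype.coe_ne_coe.1 hki) (Subtype.coe_ne_coe.1 hkj) ha
      (fun h => ha ((hf.cartanEven_eq hn hki hkj).trans h)) ?_ ?_ s r
    exacts [affineD_fork_iff.not.2 (hf.not_isFork hn hkj),
      affineD_fork_iff.not.2 ((isFork_comm.1 hf).not_isFork hn hki)]

theorem freeLift_end_far (e f : Sgn) (hi : 1 ≤ i ∧ i ≤ (n : ℤ) - 2) {s : ℕ} (hs : Odd s) (r : ℕ) :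
    freeLift n y ⁅DFree.X n e i r, DFree.X n f (n + 1) s⁆ = freeLift n y 0 := by
  obtain ⟨a, b, hl, ha, hb⟩ := exists_forkLabel_end n f
  have hi' : 0 ≤ i ∧ i ≤ (n : ℤ) := by omega
  rw [LieHom.map_lie, freeLift_X _ hi', freeLift_X_of_forkLabel hl hs, lie_neg, map_zero,
    neg_eq_zero]
  exact S.lie_forkElement_eq_zero e hl.isFork hi' (by omega) (by omega) r s

theorem freeLift_start_far (e f : Sgn) (hi : 2 ≤ i ∧ i ≤ (n : ℤ) + 1) {r s : ℕ}
    (hr : ValidX n i r) (hs : Odd s) :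
    freeLift n y ⁅DFree.X n e i r, DFree.X n f (-1) s⁆ = freeLift n y 0 := by
  obtain ⟨a, b, hl, ha, hb⟩ := exists_forkLabel_start n f
  have far (e : Sgn) {i : ℤ} (hi : 2 ≤ i ∧ i ≤ (n : ℤ)) (r : ℕ) :
      ⁅y e i r, forkElement y a b s⁆ = 0 :=
    S.lie_forkElement_eq_zero e hl.isFork (by omega) (by omega) (by omega) r s
  rw [LieHom.map_lie, freeLift_X_of_forkLabel hl hs, lie_neg, map_zero, neg_eq_zero]
  rcases hr with hi' | ⟨hi', hr⟩
  · rw [freeLift_X _ hi', far e ⟨hi.1, hi'.2⟩]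
  · obtain rfl : i = (n : ℤ) + 1 := by omega
    obtain ⟨c, d, hl', hc, hd⟩ := exists_forkLabel_end n e
    have hc' := hl'.isFork.left_mem hn
    have hd' := hl'.isFork.right_mem hn
    rw [freeLift_X_of_forkLabel hl' hr, neg_lie, forkElement, lie_lie, far _ (by omega),
      far _ (by omega), lie_zero, lie_zero, sub_zero, neg_zero]

theorem freeLift_same_node (e : Sgn) {r s : ℕ} (hr : ValidX n k r) (hs : ValidX n k s) :
    freeLift n y ⁅DFree.X n e k r, DFree.X n e k s⁆ = freeLift n y 0 := by
  rw [LieHom.map_lie, map_zero]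
  rcases hr with hk | ⟨hk, hr⟩
  · rw [freeLift_X _ hk, freeLift_X _ hk]
    exact S.same_node e ⟨k, hk⟩ r s
  · replace hs : Odd s := hs.elim (fun hk' => by omega) And.right
    obtain ⟨i, j, hl⟩ : ∃ i j, ForkLabel n e k i j := by
      rcases hk with rfl | rfl
      · exact (exists_forkLabel_start n e).imp fun _ => .imp fun _ => And.left
      · exact (exists_forkLabel_end n e).imp fun _ => .imp fun _ => And.left
    rw [freeLift_X_of_forkLabel hl hr, freeLift_X_of_forkLabel hl hs, lie_neg, neg_lie, neg_neg]
    exact S.forkElement_lie_forkElement (i := ⟨i, hl.isFork.left_mem hn⟩)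
      (j := ⟨j, hl.isFork.right_mem hn⟩) (affineD_fork_iff.2 hl.isFork) r s

theorem freeLift_shift (e : Sgn) (hi : 0 ≤ i ∧ i ≤ (n : ℤ)) (hj : 0 ≤ j ∧ j ≤ (n : ℤ))
    (hf : ¬ IsFork n i j) (r s : ℕ) :
    freeLift n y ⁅DFree.X n e i (r + 1), DFree.X n e j s⁆ =
      freeLift n y ⁅DFree.X n e i r, DFree.X n e j (s + 1)⁆ := by
  simp only [LieHom.map_lie, freeLift_X _ hi, freeLift_X _ hj]
  rcases eq_or_ne i j with rfl | hij
  · exact (S.same_node e ⟨i, hi⟩ _ _).trans (S.same_node e ⟨i, hi⟩ _ _).symm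
  by_cases ha : (affineD n hn).Adj ⟨i, hi⟩ ⟨j, hj⟩
  · exact S.shift_adj e ha r s
  · have far (r s : ℕ) : ⁅y e i r, y e j s⁆ = 0 :=
      S.lie_eq_zero_of_far (i := ⟨i, hi⟩) (j := ⟨j, hj⟩) e e (Subtype.coe_ne_coe.1 hij) ha
        (affineD_fork_iff.not.2 hf) r s
    rw [far, far]

theorem freeLift_fork_shift (e : Sgn) (hf : IsFork n i j) (r s : ℕ) :
    freeLift n y ⁅DFree.X n e i (r + 1), DFree.X n e j s⁆ =
      freeLift n y (-⁅DFree.X n e i r, DFree.X n e j (s + 1)⁆) := by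
  have hi := hf.left_mem hn
  have hj := hf.right_mem hn
  simp only [map_neg, LieHom.map_lie, freeLift_X _ hi, freeLift_X _ hj]
  exact S.fork_shift_self (i := ⟨i, hi⟩) (j := ⟨j, hj⟩) e (affineD_fork_iff.2 hf) r s

theorem freeLift_serre_two (e : Sgn) (hi : 0 ≤ i ∧ i ≤ (n : ℤ)) (hj : 0 ≤ j ∧ j ≤ (n : ℤ))
    (hij : i ≠ j) (ha : cartan n 0 i j = 0) {r s : ℕ} (hrs : IsFork n i j → Even (r + s)) :
    freeLift n y ⁅DFree.X n e i r, DFree.X n e j s⁆ = freeLift n y 0 := by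
  rw [LieHom.map_lie, freeLift_X _ hi, freeLift_X _ hj, map_zero]
  by_cases hf : IsFork n i j
  · exact S.fork_even e e (i := ⟨i, hi⟩) (j := ⟨j, hj⟩) (affineD_fork_iff.2 hf) (hrs hf)
  · have ha' : ¬ (affineD n hn).Adj ⟨i, hi⟩ ⟨j, hj⟩ := fun h => by
      have := ha.symm.trans h
      omega
    exact S.lie_eq_zero_of_far (i := ⟨i, hi⟩) (j := ⟨j, hj⟩) e e (Subtype.coe_ne_coe.1 hij) ha'
      (affineD_fork_iff.not.2 hf) r s

theorem freeLift_serre_three (e : Sgn) (hi : 0 ≤ i ∧ i ≤ (n : ℤ)) (hj : 0 ≤ j ∧ j ≤ (n : ℤ))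
    (ha : cartan n 0 i j = -1) (r s u : ℕ) :
    freeLift n y ⁅DFree.X n e i r, ⁅DFree.X n e i s, DFree.X n e j u⁆⁆ = freeLift n y 0 := by
  simp only [LieHom.map_lie, freeLift_X _ hi, freeLift_X _ hj, map_zero]
  exact S.serre_adj e (i := ⟨i, hi⟩) (j := ⟨j, hj⟩) ha r s u

theorem freeLift_serre_fork (e : Sgn) (hf : IsFork n i j) (r : ℕ) :
    freeLift n y ⁅DFree.X n e i 0, ⁅DFree.X n e i 0, DFree.X n e j (2 * r + 1)⁆⁆ =
      freeLift n y 0 := by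
  have hi := hf.left_mem hn
  have hj := hf.right_mem hn
  simp only [LieHom.map_lie, freeLift_X _ hi, freeLift_X _ hj, map_zero]
  exact S.serre_fork e (i := ⟨i, hi⟩) (j := ⟨j, hj⟩) (affineD_fork_iff.2 hf) r

theorem freeLift_rel (loop : ∀ u,
      ⁅y .pos 1 1, ⁅y .neg 1 0, loopCartan n (fun i => y .pos i 0) (fun i => y .neg i 0) u⁆⁆ -
        ⁅y .pos 1 0, ⁅y .neg 1 1, loopCartan n (fun i => y .pos i 0) (fun i => y .neg i 0) u⁆⁆ = 0)
    {a b : DFree n} (hab : DRel n a b) : freeLift n y a = freeLift n y b := by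
  have zero_one : IsFork n 0 1 := by simp [IsFork]
  have pred_last : IsFork n (n - 1) n := by simp [IsFork]
  cases hab with
  | hh i j r s hi hj => exact S.freeLift_H_lie_H hi hj
  | hx e i j r s hi hj => exact S.freeLift_H_lie_X e hi hj s
  | xx_same i r s hi => exact S.freeLift_X_pos_lie_X_neg_self hi r s
  | xx_diff i j r s hi hj hij hf => exact S.freeLift_X_pos_lie_X_neg hi hj hij hf r s
  | xx_pred_last r s => exact S.freeLift_negOdd .end_neg r s
  | xx_last_pred r s => exact S.freeLift_negOdd .end_pos r s
  | xx_zero_one r s => exact S.freeLift_negOdd .start_pos r s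
  | xx_one_zero r s => exact S.freeLift_negOdd .start_neg r s
  | end_far e f i r s hi hs => exact S.freeLift_end_far e f hi hs r
  | start_far e f i r s hi hr hs => exact S.freeLift_start_far e f hi hr hs
  | end_pred_pp r s hs => exact S.freeLift_X_pos_lie_X_fork .end_pos hs r
  | end_pred_mp r s hs => exact S.freeLift_X_neg_lie_X_fork_self .end_pos hs r
  | end_pred_pm r s hs => exact S.freeLift_X_pos_lie_X_fork_self .end_neg hs r
  | end_pred_mm r s hs => exact S.freeLift_X_neg_lie_X_fork .end_neg hs r
  | end_last_pp r s hs => exact S.freeLift_X_pos_lie_X_fork_self .end_pos hs r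
  | end_last_mp r s hs => exact S.freeLift_X_neg_lie_X_fork .end_pos hs r
  | end_last_pm r s hs => exact S.freeLift_X_pos_lie_X_fork .end_neg hs r
  | end_last_mm r s hs => exact S.freeLift_X_neg_lie_X_fork_self .end_neg hs r
  | start_zero_pp r s hs => exact S.freeLift_X_pos_lie_X_fork_self .start_pos hs r
  | start_zero_mp r s hs => exact S.freeLift_X_neg_lie_X_fork .start_pos hs r
  | start_zero_pm r s hs => exact S.freeLift_X_pos_lie_X_fork .start_neg hs r
  | start_zero_mm r s hs => exact S.freeLift_X_neg_lie_X_fork_self .start_neg hs r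
  | start_one_pp r s hs => exact S.freeLift_X_pos_lie_X_fork .start_pos hs r
  | start_one_mp r s hs => exact S.freeLift_X_neg_lie_X_fork_self .start_pos hs r
  | start_one_pm r s hs => exact S.freeLift_X_pos_lie_X_fork_self .start_neg hs r
  | start_one_mm r s hs => exact S.freeLift_X_neg_lie_X_fork .start_neg hs r
  | same_node e i r s hr hs => exact S.freeLift_same_node e hr hs
  | shift e i j r s hij hf => exact S.freeLift_shift e (by omega) (by omega) hf r s
  | shift_zero_one e r s => exact S.freeLift_fork_shift e zero_one r s
  | shift_pred_last e r s => exact S.freeLift_fork_shift e pred_last r s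
  | serre_two e i j r s hi hj hij ha hf => exact S.freeLift_serre_two e hi hj hij ha hf
  | serre_three e i j r s u hi hj ha => exact S.freeLift_serre_three e hi hj ha r s u
  | serre_fork e i j r hf => exact S.freeLift_serre_fork e hf r
  | loop u =>
    have h1 : 0 ≤ (1 : ℤ) ∧ (1 : ℤ) ≤ n := by omega
    simp only [map_sub, LieHom.map_lie, map_loopCartan, freeLift_X _ h1, map_zero]
    rw [loopCartan_congr (by omega) (fun i hi => freeLift_X _ hi 0) (fun i hi => freeLift_X _ hi 0)]
    exact loop u

end CurrentSystem

section LieAlgebra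

variable {R L L' : Type*} [CommRing R] [LieRing L] [LieAlgebra R L] [LieRing L'] [LieAlgebra R L']

/-- The homomorphism from the quotient by a Lie ideal `I` induced by a homomorphism which vanishes
on `I`. -/
def lieQuotientLift (I : LieIdeal R L) (f : L →ₗ⁅R⁆ L') (hI : I ≤ f.ker) : L ⧸ I →ₗ⁅R⁆ L' where
  __ := I.toSubmodule.liftQ (f : L →ₗ[R] L') fun a ha => f.mem_ker.1 (hI ha)
  map_lie' {a b} := by
    obtain ⟨a, rfl⟩ := LieSubmodule.Quotient.surjective_mk' I a
    obtain ⟨b, rfl⟩ := LieSubmodule.Quotient.surjective_mk' I b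
    exact f.map_lie a b

theorem lieHom_ext_of_lieSpan_eq_top {s : Set L} (hs : LieSubalgebra.lieSpan R L s = ⊤)
    {f g : L →ₗ⁅R⁆ L'} (hfg : Set.EqOn f g s) : f = g := by
  ext a
  have ha : a ∈ LieSubalgebra.lieSpan R L s := hs ▸ LieSubalgebra.mem_top a
  induction ha using LieSubalgebra.lieSpan_induction with
  | mem a ha => exact hfg ha
  | zero => rw [map_zero, map_zero]
  | add a b _ _ iha ihb => rw [map_add, map_add, iha, ihb]
  | smul c a _ iha => rw [map_smul, map_smul, iha]
  | lie a b _ _ iha ihb => rw [LieHom.map_lie, LieHom.map_lie, iha, ihb]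

theorem freeLieAlgebra_hom_mem {α : Type*} (f : FreeLieAlgebra R α →ₗ⁅R⁆ L)
    {K : LieSubalgebra R L} (hK : ∀ g, f (FreeLieAlgebra.of R g) ∈ K) (a : FreeLieAlgebra R α) :
    f a ∈ K := by
  let f' : FreeLieAlgebra R α →ₗ⁅R⁆ K := FreeLieAlgebra.lift R fun g => ⟨_, hK g⟩
  have hf' : f = K.incl.comp f' := FreeLieAlgebra.hom_ext fun g => by
    rw [LieHom.comp_apply, FreeLieAlgebra.lift_of_apply, LieSubalgebra.coe_incl]
  exact hf' ▸ (f' a).2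

end LieAlgebra

namespace D

variable {n : ℕ}

/-- The projection from the free Lie algebra onto `D(2n)`. -/
noncomputable def mk (n : ℕ) : DFree n →ₗ⁅ℂ⁆ D n where
  __ := (LieSubmodule.Quotient.mk' (DIdeal n) : DFree n →ₗ[ℂ] D n)
  map_lie' := rfl

theorem mk_surjective (n : ℕ) : Function.Surjective (mk n) :=
  LieSubmodule.Quotient.surjective_mk' (DIdeal n)

theorem mk_H (i : ℤ) (r : ℕ) : mk n (DFree.H n i r) = H n i r := rfl

theorem mk_X (e : Sgn) (i : ℤ) (r : ℕ) : mk n (DFree.X n e i r) = X n e i r := rfl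

theorem mk_eq_of_rel {a b : DFree n} (hab : DRel n a b) : mk n a = mk n b := by
  rw [← sub_eq_zero, ← map_sub]
  exact (LieSubmodule.Quotient.mk_eq_zero (N := DIdeal n)).2
    (LieSubmodule.subset_lieSpan ⟨a, b, hab, rfl⟩)

/-- The homomorphism from `D(2n)` induced by a homomorphism which respects its relations. -/
noncomputable def lift {L : Type*} [LieRing L] [LieAlgebra ℂ L] (f : DFree n →ₗ⁅ℂ⁆ L)
    (hf : ∀ {a b}, DRel n a b → f a = f b) : D n →ₗ⁅ℂ⁆ L :=
  lieQuotientLift (DIdeal n) f <| LieSubmodule.lieSpan_le.2 <| by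
    rintro _ ⟨a, b, hab, rfl⟩
    exact f.mem_ker.2 (by rw [map_sub, hf hab, sub_self])

theorem lift_mk {L : Type*} [LieRing L] [LieAlgebra ℂ L] (f : DFree n →ₗ⁅ℂ⁆ L)
    (hf : ∀ {a b}, DRel n a b → f a = f b) (a : DFree n) : lift f hf (mk n a) = f a := rfl

theorem H_lie_H {i j : ℤ} {r s : ℕ} (hi : ValidH n i r) (hj : ValidH n j s) :
    ⁅H n i r, H n j s⁆ = 0 := by
  simpa only [LieHom.map_lie, map_zero, mk_H] using mk_eq_of_rel (.hh i j r s hi hj)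

theorem H_lie_X (e : Sgn) {i j : ℤ} {r : ℕ} (hi : ValidH n i r) (hj : 0 ≤ j ∧ j ≤ (n : ℤ))
    (s : ℕ) : ⁅H n i r, X n e j s⁆ = (e.toInt * cartan n r i j) • X n e j (r + s) := by
  simpa only [LieHom.map_lie, map_zsmul, mk_H, mk_X] using mk_eq_of_rel (.hx e i j r s hi hj)

theorem X_pos_lie_X_neg_self {i : ℤ} (hi : 0 ≤ i ∧ i ≤ (n : ℤ)) (r s : ℕ) :
    ⁅X n .pos i r, X n .neg i s⁆ = mk n (DFree.coroot n i (r + s)) := by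
  simpa only [LieHom.map_lie, mk_X] using mk_eq_of_rel (.xx_same i r s hi)

theorem X_pos_lie_X_neg_of_forkLabel {e : Sgn} {k i j : ℤ} (hl : ForkLabel n e k i j) (r s : ℕ) :
    ⁅X n .pos i r, X n .neg j s⁆ = mk n (DFree.negOdd n e k (r + s)) := by
  cases hl
  exacts [mk_eq_of_rel (.xx_zero_one r s), mk_eq_of_rel (.xx_one_zero r s),
    mk_eq_of_rel (.xx_last_pred r s), mk_eq_of_rel (.xx_pred_last r s)]

theorem X_pos_lie_X_neg {i j : ℤ} (hi : 0 ≤ i ∧ i ≤ (n : ℤ)) (hj : 0 ≤ j ∧ j ≤ (n : ℤ))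
    (hij : i ≠ j) : ⁅X n .pos i 0, X n .neg j 0⁆ = 0 := by
  by_cases hf : IsFork n i j
  · obtain ⟨e, k, hl⟩ := hf.exists_forkLabel
    rw [X_pos_lie_X_neg_of_forkLabel hl, DFree.negOdd, if_neg (by decide), map_zero]
  · simpa only [LieHom.map_lie, map_zero, mk_X] using
      mk_eq_of_rel (.xx_diff i j 0 0 hi hj hij hf)

theorem lie_X_eq_zero_of_fork {i j : ℤ} (hn : 4 ≤ n) (e : Sgn) (hf : IsFork n i j) :
    ⁅⁅X n .pos i 1, X n .neg i 1⁆, X n e j 0⁆ = 0 := by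
  have hi := hf.left_mem hn
  rw [X_pos_lie_X_neg_self hi, one_add_one_eq_two, DFree.coroot_of_even i even_two, mk_H,
    H_lie_X e (validH_of_even hi even_two) (hf.right_mem hn), cartan, if_pos even_two,
    hf.cartanEven_eq_zero hn, mul_zero, zero_smul]

theorem X_lie_X_same_node (e : Sgn) {i : ℤ} (hi : 0 ≤ i ∧ i ≤ (n : ℤ)) :
    ⁅X n e i 1, X n e i 0⁆ = 0 := by
  simpa only [LieHom.map_lie, map_zero, mk_X] using
    mk_eq_of_rel (.same_node e i 1 0 (.inl hi) (.inl hi))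

theorem serre_two (e : Sgn) {i j : ℤ} (hi : 0 ≤ i ∧ i ≤ (n : ℤ)) (hj : 0 ≤ j ∧ j ≤ (n : ℤ))
    (ha : cartan n 0 i j = 0) : ⁅X n e i 0, X n e j 0⁆ = 0 := by
  have hij : i ≠ j := by
    rintro rfl
    simp [cartan, cartanEven] at ha
  simpa only [LieHom.map_lie, map_zero, mk_X] using
    mk_eq_of_rel (.serre_two e i j 0 0 hi hj hij ha fun _ => .zero)

theorem serre_three (e : Sgn) {i j : ℤ} (hi : 0 ≤ i ∧ i ≤ (n : ℤ)) (hj : 0 ≤ j ∧ j ≤ (n : ℤ))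
    (ha : cartan n 0 i j = -1) : ⁅X n e i 0, ⁅X n e i 0, X n e j 0⁆⁆ = 0 := by
  simpa only [LieHom.map_lie, map_zero, mk_X] using
    mk_eq_of_rel (.serre_three e i j 0 0 0 hi hj ha)

theorem loop (n : ℕ) (u : ℤ) :
    ⁅X n .pos 1 1, ⁅X n .neg 1 0,
        loopCartan n (fun i => X n .pos i 0) (fun i => X n .neg i 0) u⁆⁆ -
      ⁅X n .pos 1 0, ⁅X n .neg 1 1,
        loopCartan n (fun i => X n .pos i 0) (fun i => X n .neg i 0) u⁆⁆ = 0 := by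
  simpa only [map_sub, LieHom.map_lie, map_loopCartan, map_zero, mk_X] using
    mk_eq_of_rel (.loop u)

theorem X_succ (hn : 4 ≤ n) (e : Sgn) {i : ℤ} (hi : 0 ≤ i ∧ i ≤ (n : ℤ)) (r : ℕ) :
    X n e i (r + 1) = ((e.toInt : ℂ) / 2) • ⁅H n (foldNode n i) 1, X n e i r⁆ := by
  rw [H_lie_X e (.inl (foldNode_mem hn hi)) hi, cartan, if_neg (by decide),
    cartanOdd_foldNode_self hn hi, ← Int.cast_smul_eq_zsmul ℂ, smul_smul, add_comm 1]
  cases e <;> norm_num [Sgn.toInt]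

/-- The generators of `D(2n)` that also occur in the minimalistic presentation. -/
def lowGenerators (n : ℕ) : Set (D n) :=
  {y | ∃ (i : ℤ) (r : ℕ), ValidMinH n i r ∧ y = H n i r} ∪
    {y | ∃ (s : Sgn) (i : ℤ) (r : ℕ), ValidMinX n i r ∧ y = X n s i r}

theorem X_mem_of_node (hn : 4 ≤ n) (e : Sgn) {i : ℤ} (hi : 0 ≤ i ∧ i ≤ (n : ℤ)) (r : ℕ) :
    X n e i r ∈ LieSubalgebra.lieSpan ℂ (D n) (lowGenerators n) := by
  induction r with
  | zero => exact LieSubalgebra.subset_lieSpan (.inr ⟨e, i, 0, ⟨hi.1, hi.2, .inl rfl⟩, rfl⟩)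
  | succ r ih =>
    rw [X_succ hn e hi]
    exact SMulMemClass.smul_mem _ (LieSubalgebra.lie_mem _ (LieSubalgebra.subset_lieSpan
      (.inl ⟨_, 1, validMinH_foldNode hn hi, rfl⟩)) ih)

theorem H_mem (hn : 4 ≤ n) {i : ℤ} {r : ℕ} (hi : ValidH n i r) :
    H n i r ∈ LieSubalgebra.lieSpan ℂ (D n) (lowGenerators n) := by
  rw [← mk_H, ← DFree.coroot_of_validH hi, ← add_zero r, ← X_pos_lie_X_neg_self (hi.mem hn)]
  exact LieSubalgebra.lie_mem _ (X_mem_of_node hn _ (hi.mem hn) _)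
    (X_mem_of_node hn _ (hi.mem hn) _)

theorem X_mem_of_forkLabel (hn : 4 ≤ n) {e : Sgn} {k i j : ℤ} (hl : ForkLabel n e k i j) {r : ℕ}
    (hr : Odd r) : X n e k r ∈ LieSubalgebra.lieSpan ℂ (D n) (lowGenerators n) := by
  have hX := X_pos_lie_X_neg_of_forkLabel hl r 0
  rw [add_zero, DFree.negOdd, if_pos hr, map_neg, mk_X] at hX
  rw [← neg_neg (X n e k r), ← hX]
  exact neg_mem (LieSubalgebra.lie_mem _ (X_mem_of_node hn _ (hl.isFork.left_mem hn) _)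
    (X_mem_of_node hn _ (hl.isFork.right_mem hn) _))

theorem X_mem (hn : 4 ≤ n) (e : Sgn) {i : ℤ} {r : ℕ} (hi : ValidX n i r) :
    X n e i r ∈ LieSubalgebra.lieSpan ℂ (D n) (lowGenerators n) := by
  rcases hi with hi | ⟨rfl | rfl, hr⟩
  · exact X_mem_of_node hn e hi r
  · obtain ⟨i, j, hl, -⟩ := exists_forkLabel_start n e
    exact X_mem_of_forkLabel hn hl hr
  · obtain ⟨i, j, hl, -⟩ := exists_forkLabel_end n e
    exact X_mem_of_forkLabel hn hl hr

theorem lieSpan_lowGenerators (hn : 4 ≤ n) :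
    LieSubalgebra.lieSpan ℂ (D n) (lowGenerators n) = ⊤ := by
  refine eq_top_iff.2 fun y _ => ?_
  obtain ⟨a, rfl⟩ := mk_surjective n y
  refine freeLieAlgebra_hom_mem (mk n) (fun g => ?_) a
  cases g with
  | H i r hi => simpa only [← mk_H, DFree.H, dif_pos hi] using H_mem hn hi
  | X e i r hi => simpa only [← mk_X, DFree.X, dif_pos hi] using X_mem hn e hi

end D

section Isomorphism

attribute [local instance] LieRing.ofAssociativeRing

open UniversalEnvelopingAlgebra (ι)

variable {n : ℕ}

theorem ValidMinH.validH {i : ℤ} {r : ℕ} (hi : ValidMinH n i r) : ValidH n i r := by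
  rcases hi with ⟨h₀, hₙ, rfl⟩ | ⟨h₁, hₙ, rfl⟩
  exacts [validH_of_even ⟨h₀, hₙ⟩ .zero, .inl ⟨h₁, hₙ⟩]

theorem DMin.loop_loopX (hn : 4 ≤ n) (u : ℤ) :
    ⁅loopX n .pos 1 1, ⁅loopX n .neg 1 0,
        loopCartan n (fun i => loopX n .pos i 0) (fun i => loopX n .neg i 0) u⁆⁆ -
      ⁅loopX n .pos 1 0, ⁅loopX n .neg 1 1,
        loopCartan n (fun i => loopX n .pos i 0) (fun i => loopX n .neg i 0) u⁆⁆ = 0 := by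
  have h1 : 0 ≤ (1 : ℤ) ∧ (1 : ℤ) ≤ n := by omega
  have loop_eq := mk_eq_of_rel (.loop (n := n) u)
  simp only [map_sub, LieHom.map_lie, map_loopCartan, map_zero, mk_x] at loop_eq
  rw [loopX_of_le_one hn .pos h1 le_rfl, loopX_of_le_one hn .neg h1 le_rfl]
  exact loop_eq

theorem DMin.freeLift_loopX_rel (hn : 4 ≤ n) {a b : DFree n} (hab : DRel n a b) :
    freeLift n (loopX n) a = freeLift n (loopX n) b :=
  have := IsAddTorsionFree.of_isTorsionFree ℂ (DMin n)
  (currentSystem hn).freeLift_rel (loop_loopX hn) hab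

/-- The homomorphism `U(D(2n)) → D̃(2n)`. -/
noncomputable def ofEnveloping (hn : 4 ≤ n) : UniversalEnvelopingAlgebra ℂ (D n) →ₐ[ℂ] DMin n :=
  UniversalEnvelopingAlgebra.lift ℂ
    (D.lift (freeLift n (DMin.loopX n)) (DMin.freeLift_loopX_rel hn))

theorem ofEnveloping_X (hn : 4 ≤ n) (e : Sgn) {i : ℤ} {r : ℕ} (hi : ValidMinX n i r) :
    ofEnveloping hn (ι ℂ (D.X n e i r)) = DMin.x n e i r := by
  have hi' : 0 ≤ i ∧ i ≤ (n : ℤ) := ⟨hi.1, hi.2.1⟩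
  rw [ofEnveloping, UniversalEnvelopingAlgebra.lift_ι_apply, ← D.mk_X, D.lift_mk,
    freeLift_X e hi', DMin.loopX_of_le_one hn e hi' (hi.2.2.elim (by omega) (by omega))]

theorem ofEnveloping_H (hn : 4 ≤ n) {i : ℤ} {r : ℕ} (hi : ValidMinH n i r) :
    ofEnveloping hn (ι ℂ (D.H n i r)) = DMin.h n i r := by
  have S := DMin.currentSystem hn
  rw [ofEnveloping, UniversalEnvelopingAlgebra.lift_ι_apply, ← D.mk_H, D.lift_mk,
    freeLift_H hi.validH]
  rcases hi with ⟨h₀, hₙ, rfl⟩ | ⟨h₁, hₙ, rfl⟩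
  · exact S.loopCoroot_zero ⟨i, h₀, hₙ⟩
  · exact (S.loopCoroot_one ⟨i, by omega, by omega⟩).trans <|
      congrArg (DMin.h n · 1) (foldNode_of_mem ⟨h₁, hₙ⟩)

/-- The homomorphism from the free algebra to `U(D(2n))`. -/
noncomputable def minFreeLift (n : ℕ) : MinFree n →ₐ[ℂ] UniversalEnvelopingAlgebra ℂ (D n) :=
  FreeAlgebra.lift ℂ fun
    | .h i r _ => ι ℂ (D.H n i r)
    | .x e i r _ => ι ℂ (D.X n e i r)

theorem minFreeLift_h {i : ℤ} {r : ℕ} (hi : ValidMinH n i r) :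
    minFreeLift n (MinFree.h n i r) = ι ℂ (D.H n i r) := by
  rw [MinFree.h, dif_pos hi, minFreeLift, FreeAlgebra.lift_ι_apply]

theorem minFreeLift_x (e : Sgn) {i : ℤ} {r : ℕ} (hi : ValidMinX n i r) :
    minFreeLift n (MinFree.x n e i r) = ι ℂ (D.X n e i r) := by
  rw [MinFree.x, dif_pos hi, minFreeLift, FreeAlgebra.lift_ι_apply]

theorem minFreeLift_x_zero (e : Sgn) {i : ℤ} (hi : 0 ≤ i ∧ i ≤ (n : ℤ)) :
    minFreeLift n (MinFree.x n e i 0) = ι ℂ (D.X n e i 0) :=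
  minFreeLift_x e ⟨hi.1, hi.2, .inl rfl⟩

theorem minFreeLift_x_one (e : Sgn) {i : ℤ} (hi : 0 ≤ i ∧ i ≤ (n : ℤ)) :
    minFreeLift n (MinFree.x n e i 1) = ι ℂ (D.X n e i 1) :=
  minFreeLift_x e ⟨hi.1, hi.2, .inr rfl⟩

theorem minFreeLift_lie (a b : MinFree n) :
    minFreeLift n ⁅a, b⁆ = ⁅minFreeLift n a, minFreeLift n b⁆ :=
  (minFreeLift n).toLieHom.map_lie a b

theorem minFreeLift_h_lie_x (e : Sgn) {i j : ℤ} {r : ℕ} (hi : ValidMinH n i r)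
    (hj : 0 ≤ j ∧ j ≤ (n : ℤ)) :
    minFreeLift n ⁅MinFree.h n i r, MinFree.x n e j 0⁆ =
      minFreeLift n ((e.toInt * cartan n r i j) • MinFree.x n e j r) := by
  have hr : r = 0 ∨ r = 1 := hi.imp (fun h => h.2.2) fun h => h.2.2
  rw [minFreeLift_lie, minFreeLift_h hi, minFreeLift_x_zero e hj, ← LieHom.map_lie,
    D.H_lie_X e hi.validH hj, add_zero, map_zsmul, map_zsmul, minFreeLift_x e ⟨hj.1, hj.2, hr⟩]

theorem minFreeLift_x_pos_lie_x_neg {i : ℤ} (hi : 0 ≤ i ∧ i ≤ (n : ℤ)) :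
    minFreeLift n ⁅MinFree.x n .pos i 0, MinFree.x n .neg i 0⁆ =
      minFreeLift n (MinFree.h n i 0) := by
  rw [minFreeLift_lie, minFreeLift_x_zero _ hi, minFreeLift_x_zero _ hi, ← LieHom.map_lie,
    D.X_pos_lie_X_neg_self hi, add_zero, DFree.coroot_of_even i .zero, D.mk_H,
    minFreeLift_h (.inl ⟨hi.1, hi.2, rfl⟩)]

theorem minFreeLift_x_pos_one_lie_x_neg (hn : 4 ≤ n) {i : ℤ} (hi : 0 ≤ i ∧ i ≤ (n : ℤ)) :
    minFreeLift n ⁅MinFree.x n .pos i 1, MinFree.x n .neg i 0⁆ =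
      minFreeLift n (MinFree.h n (foldNode n i) 1) := by
  rw [minFreeLift_lie, minFreeLift_x_one _ hi, minFreeLift_x_zero _ hi, ← LieHom.map_lie,
    D.X_pos_lie_X_neg_self hi, add_zero, DFree.coroot_of_odd i odd_one, D.mk_H,
    minFreeLift_h (validMinH_foldNode hn hi)]

theorem minFreeLift_fork (hn : 4 ≤ n) (e : Sgn) {i j : ℤ} (hf : IsFork n i j) :
    minFreeLift n ⁅⁅MinFree.x n .pos i 1, MinFree.x n .neg i 1⁆, MinFree.x n e j 0⁆ =
      minFreeLift n 0 := by
  have hi := hf.left_mem hn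
  rw [minFreeLift_lie, minFreeLift_lie, minFreeLift_x_one _ hi, minFreeLift_x_one _ hi,
    minFreeLift_x_zero e (hf.right_mem hn), ← LieHom.map_lie, ← LieHom.map_lie,
    D.lie_X_eq_zero_of_fork hn e hf, map_zero, map_zero]

theorem minFreeLift_loop (hn : 4 ≤ n) (u : ℤ) :
    minFreeLift n
        (⁅MinFree.x n .pos 1 1, ⁅MinFree.x n .neg 1 0,
            loopCartan n (fun i => MinFree.x n .pos i 0) (fun i => MinFree.x n .neg i 0) u⁆⁆ -
          ⁅MinFree.x n .pos 1 0, ⁅MinFree.x n .neg 1 1,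
            loopCartan n (fun i => MinFree.x n .pos i 0) (fun i => MinFree.x n .neg i 0) u⁆⁆) =
      minFreeLift n 0 := by
  have h1 : 0 ≤ (1 : ℤ) ∧ (1 : ℤ) ≤ n := by omega
  have map_loop : minFreeLift n
      (loopCartan n (fun i => MinFree.x n .pos i 0) (fun i => MinFree.x n .neg i 0) u) =
        ι ℂ (loopCartan n (fun i => D.X n .pos i 0) (fun i => D.X n .neg i 0) u) := by
    rw [map_loopCartan]
    exact (map_loopCartan (minFreeLift n).toLieHom n _ _ u).trans <| loopCartan_congr (by omega)
      (fun i hi => minFreeLift_x_zero _ hi) (fun i hi => minFreeLift_x_zero _ hi) u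
  simp only [map_sub, minFreeLift_lie, map_loop, minFreeLift_x_zero _ h1, minFreeLift_x_one _ h1,
    ← LieHom.map_lie]
  rw [← map_sub, D.loop, map_zero, map_zero]

theorem minFreeLift_rel (hn : 4 ≤ n) {a b : MinFree n} (hab : MinRel n a b) :
    minFreeLift n a = minFreeLift n b := by
  cases hab with
  | hh i j r s hi hj =>
    rw [minFreeLift_lie, minFreeLift_h hi, minFreeLift_h hj, ← LieHom.map_lie,
      D.H_lie_H hi.validH hj.validH, map_zero, map_zero]
  | hx e i j r hi hj => exact minFreeLift_h_lie_x e hi hj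
  | xx_same i hi => exact minFreeLift_x_pos_lie_x_neg hi
  | xx_diff i j hi hj hij =>
    rw [minFreeLift_lie, minFreeLift_x_zero _ hi, minFreeLift_x_zero _ hj, ← LieHom.map_lie,
      D.X_pos_lie_X_neg hi hj hij, map_zero, map_zero]
  | xx_one_mid i hi =>
    rw [minFreeLift_x_pos_one_lie_x_neg hn (by omega), foldNode_of_mem hi]
  | xx_one_last =>
    rw [minFreeLift_x_pos_one_lie_x_neg hn (by omega), foldNode, if_neg (by omega), if_pos rfl]
  | xx_one_zero => rw [minFreeLift_x_pos_one_lie_x_neg hn (by omega), foldNode, if_pos rfl]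
  | same_node e i hi =>
    rw [minFreeLift_lie, minFreeLift_x_one _ hi, minFreeLift_x_zero _ hi, ← LieHom.map_lie,
      D.X_lie_X_same_node e hi, map_zero, map_zero]
  | serre_two e i j hi hj ha =>
    rw [minFreeLift_lie, minFreeLift_x_zero _ hi, minFreeLift_x_zero _ hj, ← LieHom.map_lie,
      D.serre_two e hi hj ha, map_zero, map_zero]
  | serre_three e i j hi hj ha =>
    rw [minFreeLift_lie, minFreeLift_lie, minFreeLift_x_zero _ hi, minFreeLift_x_zero _ hj,
      ← LieHom.map_lie, ← LieHom.map_lie, D.serre_three e hi hj ha, map_zero, map_zero]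
  | fork_last e => exact minFreeLift_fork hn e (.inr (.inr (.inl ⟨rfl, rfl⟩)))
  | fork_zero e => exact minFreeLift_fork hn e (.inl ⟨rfl, rfl⟩)
  | loop u => exact minFreeLift_loop hn u

/-- The homomorphism `D̃(2n) → U(D(2n))`. -/
noncomputable def toEnveloping (hn : 4 ≤ n) : DMin n →ₐ[ℂ] UniversalEnvelopingAlgebra ℂ (D n) :=
  RingQuot.liftAlgHom ℂ ⟨minFreeLift n, fun _ _ => minFreeLift_rel hn⟩

theorem toEnveloping_h (hn : 4 ≤ n) {i : ℤ} {r : ℕ} (hi : ValidMinH n i r) :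
    toEnveloping hn (DMin.h n i r) = ι ℂ (D.H n i r) := by
  rw [toEnveloping, DMin.h, RingQuot.liftAlgHom_mkAlgHom_apply, minFreeLift_h hi]

theorem toEnveloping_x (hn : 4 ≤ n) (e : Sgn) {i : ℤ} {r : ℕ} (hi : ValidMinX n i r) :
    toEnveloping hn (DMin.x n e i r) = ι ℂ (D.X n e i r) := by
  rw [toEnveloping, DMin.x, RingQuot.liftAlgHom_mkAlgHom_apply, minFreeLift_x e hi]

theorem toEnveloping_comp_ofEnveloping (hn : 4 ≤ n) :
    (toEnveloping hn).comp (ofEnveloping hn) = AlgHom.id ℂ _ := by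
  refine UniversalEnvelopingAlgebra.hom_ext _ <|
    lieHom_ext_of_lieSpan_eq_top (D.lieSpan_lowGenerators hn) ?_
  rintro _ (⟨i, r, hi, rfl⟩ | ⟨e, i, r, hi, rfl⟩)
  · exact (congrArg _ (ofEnveloping_H hn hi)).trans (toEnveloping_h hn hi)
  · exact (congrArg _ (ofEnveloping_X hn e hi)).trans (toEnveloping_x hn e hi)

theorem ofEnveloping_comp_toEnveloping (hn : 4 ≤ n) :
    (ofEnveloping hn).comp (toEnveloping hn) = AlgHom.id ℂ (DMin n) := by
  refine RingQuot.ringQuot_ext' ℂ _ _ (FreeAlgebra.hom_ext (funext fun g => ?_))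
  cases g with
  | h i r hi =>
    have h_fixed := (congrArg _ (toEnveloping_h hn hi)).trans (ofEnveloping_H hn hi)
    rwa [DMin.h, MinFree.h, dif_pos hi] at h_fixed
  | x e i r hi =>
    have x_fixed := (congrArg _ (toEnveloping_x hn e hi)).trans (ofEnveloping_X hn e hi)
    rwa [DMin.x, MinFree.x, dif_pos hi] at x_fixed

end Isomorphism

end TwistedD

theorem mainTheorem3 (n : ℕ) (hn : 4 ≤ n) :
    (∃ e : TwistedD.DMin n ≃ₐ[ℂ] UniversalEnvelopingAlgebra ℂ (TwistedD.D n),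
      (∀ (i : ℤ) (r : ℕ), TwistedD.ValidMinH n i r →
        e (TwistedD.DMin.h n i r) = UniversalEnvelopingAlgebra.ι ℂ (TwistedD.D.H n i r)) ∧
      (∀ (s : TwistedD.Sgn) (i : ℤ) (r : ℕ), TwistedD.ValidMinX n i r →
        e (TwistedD.DMin.x n s i r) = UniversalEnvelopingAlgebra.ι ℂ (TwistedD.D.X n s i r))) ∧
    LieSubalgebra.lieSpan ℂ (TwistedD.D n)
      ({y | ∃ (i : ℤ) (r : ℕ), TwistedD.ValidMinH n i r ∧ y = TwistedD.D.H n i r} ∪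
        {y | ∃ (s : TwistedD.Sgn) (i : ℤ) (r : ℕ), TwistedD.ValidMinX n i r ∧
          y = TwistedD.D.X n s i r}) = ⊤ :=
  ⟨⟨AlgEquiv.ofAlgHom (TwistedD.toEnveloping hn) (TwistedD.ofEnveloping hn)
      (TwistedD.toEnveloping_comp_ofEnveloping hn) (TwistedD.ofEnveloping_comp_toEnveloping hn),
    fun _ _ hi => TwistedD.toEnveloping_h hn hi,
    fun e _ _ hi => TwistedD.toEnveloping_x hn e hi⟩,
    TwistedD.D.lieSpan_lowGenerators hn⟩
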